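/- All vector spaces are over $\mathbb C$. Let $(V,Y,\mathbf 1,\omega)$ be a vertex operator algebra: $V=\bigoplus_{n\in\mathbb Z}V_{(n)}$ with $\dim V_{(n)}<\infty$ and $V_{(n)}=0$ for $n$ sufficiently small, $\mathbf 1\in V_{(0)}$, $\omega\in V_{(2)}$, and $Y(v,x)=\sum_{n\in\mathbb Z}v_nx^{-n-1}$ satisfies lower truncation, the vacuum and creation properties, the Jacobi identity, the Virasoro relations for $L(n)=\omega_{n+1}$ (with some central charge, the rank of $V$), the $L(-1)$-derivative property, and $L(0)v=nv$ for $v\in V_{(n)}$. A $V$-module is a space $W=\bigoplus_{n\in\mathbb C}W_{(n)}$ with $\dim W_{(n)}<\infty$ and $W_{(n)}=0$ for $n$ of sufficiently small real part, together with a linear map $v\mapsto Y_W(v,x)=\sum_{n\in\mathbb Z}v_nx^{-n-1}$ into $(\operatorname{End}W)[[x,x^{-1}]]$ satisfying lower truncation, $Y_W(\mathbf 1,x)=1$, the Jacobi identity, the Virasoro relations with the rank of $V$ as central charge, the $L(-1)$-derivative property, and $L(0)w=nw$ for $w\in W_{(n)}$. Its contragredient is $W'=\bigoplus_{n\in\mathbb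 C}W_{(n)}^*$ with $$\langle Y'(v,x)w',w\rangle=\langle w',Y_W(e^{xL(1)}(-x^{-2})^{L(0)}v,x^{-1})w\rangle .$$ For $V$-modules $W_1,W_2,W_3$, an intertwining operator of type $\binom{W_3}{W_1W_2}$ is a linear map $$W_1\otimes W_2\to W_3\{x\},\qquad w_{(1)}\otimes w_{(2)}\mapsto\mathcal Y(w_{(1)},x)w_{(2)}=\sum_{n\in\mathbb C}(w_{(1)})_nw_{(2)}\,x^{-n-1},$$ such that $(w_{(1)})_nw_{(2)}=0$ whenever the real part of $n$ is sufficiently large (depending on $w_{(1)},w_{(2)}$), such that $\frac{d}{dx}\mathcal Y(w_{(1)},x)=\mathcal Y(L(-1)w_{(1)},x)$, and such that for all $v\in V$, $w_{(1)}\in W_1$, $w_{(2)}\in W_2$ $$x_0^{-1}\delta\!\left(\tfrac{x_1-x_2}{x_0}\right)Y_3(v,x_1)\mathcal Y(w_{(1)},x_2)w_{(2)}-x_0^{-1}\delta\!\left(\tfrac{x_2-x_1}{-x_0}\right)\mathcal Y(w_{(1)},x_2)Y_2(v,x_1)w_{(2)}=x_2^{-1}\delta\!\left(\tfrac{x_1-x_0}{x_2}\right)\mathcal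 Y(Y_1(v,x_0)w_{(1)},x_2)w_{(2)}.$$ Let $N^{W_3}_{W_1W_2}$ be the dimension (possibly infinite) of the vector space of these operators, and set $N_{W_1W_2W_3}=N^{W_3'}_{W_1W_2}$. Proposition. For any $V$-modules $W_1,W_2,W_3$ and any permutation $\sigma$ of $\{1,2,3\}$, $$N_{W_1W_2W_3}=N_{W_{\sigma(1)}W_{\sigma(2)}W_{\sigma(3)}}.$$ -/

import Mathlib

open scoped VertexOperator

/-! Formal series are handled through their coefficients.  A vertex operator
`Y(v, x) = ∑ₙ vₙ x⁻ⁿ⁻¹` on `W` is Mathlib's `VertexOperator ℂ W`, a linear map from `W` to Laurent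
series with coefficients in `W` (so that `vₙ w = 0` for `n` large), and `A[[n]]` is its mode,
the coefficient of `x⁻ⁿ⁻¹`. -/

namespace VertexTheory

/-- The Jacobi identity
`x₀⁻¹δ((x₁-x₂)/x₀) Y_W(u,x₁)Y_W(v,x₂) - x₀⁻¹δ((x₂-x₁)/(-x₀)) Y_W(v,x₂)Y_W(u,x₁)
  = x₂⁻¹δ((x₁-x₀)/x₂) Y_W(Y(u,x₀)v,x₂)`:
equality of the coefficients of `x₀⁻ʳ⁻¹ x₁⁻ᵖ⁻¹ x₂⁻ᑫ⁻¹`, applied to `w`, where `(x₁-x₂)ʳ` and the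
like are expanded in nonnegative powers of the second variable.  All three sums are finite
because vertex operators are lower truncated. -/
def JacobiIdentity {V W : Type*} [AddCommGroup V] [Module ℂ V] [AddCommGroup W] [Module ℂ W]
    (Y : V →ₗ[ℂ] VertexOperator ℂ V) (YW : V →ₗ[ℂ] VertexOperator ℂ W) : Prop :=
  ∀ (u v : V) (w : W) (r p q : ℤ),
    (∑ᶠ i : ℕ, ((-1 : ℂ) ^ i * (Ring.choose r i : ℤ)) •
        ((YW u)[[p + r - i]]) (((YW v)[[q + i]]) w))
      - (∑ᶠ i : ℕ, ((-1 : ℂ) ^ r * (-1 : ℂ) ^ i * (Ring.choose r i : ℤ)) •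
        ((YW v)[[q + r - i]]) (((YW u)[[p + i]]) w))
      = ∑ᶠ i : ℕ, ((Ring.choose p i : ℤ) : ℂ) • ((YW (((Y u)[[r + i]]) v))[[p + q - i]]) w

/-- The Virasoro algebra relations with central charge `c`. -/
def VirasoroRelations {W : Type*} [AddCommGroup W] [Module ℂ W]
    (L : ℤ → Module.End ℂ W) (c : ℂ) : Prop :=
  ∀ m n : ℤ, L m * L n - L n * L m = ((m : ℂ) - n) • L (m + n)
    + (if m + n = 0 then ((m : ℂ) ^ 3 - m) / 12 * c else 0) • (1 : Module.End ℂ W)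

/-- The `L(-1)`-derivative property `d/dx Y(v, x) = Y(L(-1)v, x)`, where `Lneg` is `L(-1)`. -/
def DerivativeProperty {V W : Type*} [AddCommGroup V] [Module ℂ V] [AddCommGroup W] [Module ℂ W]
    (Lneg : Module.End ℂ V) (Y : V →ₗ[ℂ] VertexOperator ℂ W) : Prop :=
  ∀ (v : V) (n : ℤ), ((Y (Lneg v))[[n]]) = (-(n : ℂ)) • ((Y v)[[n - 1]])

end VertexTheory

open VertexTheory in
/-- A vertex operator algebra over `ℂ` with underlying space `V`; `L(n) = ω_{n+1}`. -/
structure VertexOperatorAlgebra (V : Type*) [AddCommGroup V] [Module ℂ V] where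
  /-- the weight spaces `V_(n)` -/
  grade : ℤ → Submodule ℂ V
  Y : V →ₗ[ℂ] VertexOperator ℂ V
  vac : V
  ω : V
  rank : ℂ
  isInternal : DirectSum.IsInternal grade
  finite_grade : ∀ n, FiniteDimensional ℂ (grade n)
  lower_bounded : ∃ N : ℤ, ∀ n < N, grade n = ⊥
  vac_mem : vac ∈ grade 0
  omega_mem : ω ∈ grade 2
  vacuum : ∀ n : ℤ, ((Y vac)[[n]]) = if n = -1 then 1 else 0
  creation : ∀ v, (∀ n : ℤ, 0 ≤ n → ((Y v)[[n]]) vac = 0) ∧ ((Y v)[[(-1 : ℤ)]]) vac = v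
  jacobi : JacobiIdentity Y Y
  virasoro : VirasoroRelations (fun n => ((Y ω)[[n + 1]])) rank
  derivative : DerivativeProperty ((Y ω)[[(0 : ℤ)]]) Y
  L_zero : ∀ (n : ℤ), ∀ v ∈ grade n, ((Y ω)[[(1 : ℤ)]]) v = (n : ℂ) • v

/-- The data of a module for a vertex operator algebra `V`, without the axioms: the weight
spaces, indexed by `ℂ`, and the vertex operator map. -/
structure VModuleData (V W : Type*) [AddCommGroup V] [Module ℂ V]
    [AddCommGroup W] [Module ℂ W] where
  grade : ℂ → Submodule ℂ W
  Y : V →ₗ[ℂ] VertexOperator ℂ W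

open VertexTheory in
/-- A module `W` for the vertex operator algebra `A`. -/
structure VModule {V : Type*} [AddCommGroup V] [Module ℂ V] (A : VertexOperatorAlgebra V)
    (W : Type*) [AddCommGroup W] [Module ℂ W] extends VModuleData V W where
  isInternal : DirectSum.IsInternal grade
  finite_grade : ∀ n, FiniteDimensional ℂ (grade n)
  lower_bounded : ∃ N : ℝ, ∀ n : ℂ, n.re < N → grade n = ⊥
  vacuum : ∀ n : ℤ, ((Y A.vac)[[n]]) = if n = -1 then 1 else 0
  jacobi : JacobiIdentity A.Y Y
  virasoro : VirasoroRelations (fun n => ((Y A.ω)[[n + 1]])) A.rank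
  derivative : DerivativeProperty ((A.Y A.ω)[[(0 : ℤ)]]) Y
  L_zero : ∀ (n : ℂ), ∀ w ∈ grade n, ((Y A.ω)[[(1 : ℤ)]]) w = n • w

/-! ### Intertwining operators and fusion rules -/

section Intertwining

variable {V W₁ W₂ W₃ : Type*} [AddCommGroup V] [Module ℂ V] [AddCommGroup W₁] [Module ℂ W₁]
  [AddCommGroup W₂] [Module ℂ W₂] [AddCommGroup W₃] [Module ℂ W₃]

/-- `𝒴 : W₁ ⊗ W₂ → W₃{x}`, `𝒴(w₁, x)w₂ = ∑_{n ∈ ℂ} (w₁)ₙ w₂ x⁻ⁿ⁻¹` with `(w₁)ₙ = 𝒴 w₁ n`, is an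
intertwining operator of type `W₃` over `W₁ W₂`.  The Jacobi identity is again the equality of
the coefficients of `x₀⁻ʳ⁻¹ x₁⁻ᵖ⁻¹ x₂⁻ᑫ⁻¹`, with `r p : ℤ` and now `q : ℂ`. -/
structure IsIntertwining (A : VertexOperatorAlgebra V) (M₁ : VModuleData V W₁)
    (M₂ : VModuleData V W₂) (M₃ : VModuleData V W₃)
    (𝒴 : W₁ →ₗ[ℂ] ℂ → (W₂ →ₗ[ℂ] W₃)) : Prop where
  truncation : ∀ w₁ w₂, ∃ N : ℝ, ∀ n : ℂ, N ≤ n.re → 𝒴 w₁ n w₂ = 0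
  jacobi : ∀ (v : V) (w₁ : W₁) (w₂ : W₂) (r p : ℤ) (q : ℂ),
    (∑ᶠ i : ℕ, ((-1 : ℂ) ^ i * (Ring.choose r i : ℤ)) •
        ((M₃.Y v)[[p + r - i]]) (𝒴 w₁ (q + i) w₂))
      - (∑ᶠ i : ℕ, ((-1 : ℂ) ^ r * (-1 : ℂ) ^ i * (Ring.choose r i : ℤ)) •
        𝒴 w₁ (q + r - i) (((M₂.Y v)[[p + i]]) w₂))
      = ∑ᶠ i : ℕ, ((Ring.choose p i : ℤ) : ℂ) • 𝒴 (((M₁.Y v)[[r + i]]) w₁) (p + q - i) w₂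
  derivative : ∀ (w₁ : W₁) (n : ℂ), 𝒴 (((M₁.Y A.ω)[[(0 : ℤ)]]) w₁) n = (-n) • 𝒴 w₁ (n - 1)

theorem VertexOperator.eventually_ncoeff_eq_zero {W : Type*} [AddCommGroup W] [Module ℂ W]
    (B : VertexOperator ℂ W) (w : W) : ∃ N : ℤ, ∀ n, N ≤ n → (B[[n]]) w = 0 := by
  refine ⟨-HahnSeries.order ((HahnModule.of ℂ).symm (B w)), fun n hn => ?_⟩
  exact VertexOperator.ncoeff_eq_zero_of_lt_order B n w (by omega)

theorem VertexTheory.finite_support_of_bound {W : Type*} [Zero W] (f : ℕ → W)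
    (h : ∃ N : ℕ, ∀ i, N ≤ i → f i = 0) : f.support.Finite := by
  obtain ⟨N, hN⟩ := h
  refine (Set.finite_lt_nat N).subset fun i hi => ?_
  by_contra hlt
  exact hi (hN i (not_lt.mp hlt))

variable {A : VertexOperatorAlgebra V} {M₁ : VModuleData V W₁}
    {M₂ : VModuleData V W₂} {M₃ : VModuleData V W₃}

theorem VertexTheory.finite_support₁ {𝒴 : W₁ →ₗ[ℂ] ℂ → (W₂ →ₗ[ℂ] W₃)}
    (h : IsIntertwining A M₁ M₂ M₃ 𝒴) (c : ℕ → ℂ) (B : ℕ → Module.End ℂ W₃)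
    (w₁ : W₁) (w₂ : W₂) (q : ℂ) :
    (Function.support fun i : ℕ => c i • B i (𝒴 w₁ (q + i) w₂)).Finite := by
  apply VertexTheory.finite_support_of_bound
  obtain ⟨N, hN⟩ := h.truncation w₁ w₂
  refine ⟨⌈N - q.re⌉₊, fun i hi => ?_⟩
  have h1 : N - q.re ≤ i := (Nat.le_ceil _).trans (by exact_mod_cast hi)
  rw [hN _ (by simp; linarith)]
  simp

theorem VertexTheory.finite_support₂ (𝒴 : W₁ →ₗ[ℂ] ℂ → (W₂ →ₗ[ℂ] W₃))
    (B : VertexOperator ℂ W₂) (c : ℕ → ℂ) (s : ℕ → ℂ)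
    (w₁ : W₁) (w₂ : W₂) (p : ℤ) :
    (Function.support fun i : ℕ => c i • 𝒴 w₁ (s i) ((B[[p + i]]) w₂)).Finite := by
  apply VertexTheory.finite_support_of_bound
  obtain ⟨N, hN⟩ := B.eventually_ncoeff_eq_zero w₂
  refine ⟨(N - p).toNat, fun i hi => ?_⟩
  rw [hN _ (by omega)]
  simp

theorem VertexTheory.finite_support₃ (𝒴 : W₁ →ₗ[ℂ] ℂ → (W₂ →ₗ[ℂ] W₃))
    (B : VertexOperator ℂ W₁) (c : ℕ → ℂ) (s : ℕ → ℂ)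
    (w₁ : W₁) (w₂ : W₂) (p : ℤ) :
    (Function.support fun i : ℕ => c i • 𝒴 ((B[[p + i]]) w₁) (s i) w₂).Finite := by
  apply VertexTheory.finite_support_of_bound
  obtain ⟨N, hN⟩ := B.eventually_ncoeff_eq_zero w₁
  refine ⟨(N - p).toNat, fun i hi => ?_⟩
  rw [hN _ (by omega)]
  simp

variable (A M₁ M₂ M₃) in
/-- The space of intertwining operators of type `W₃` over `W₁ W₂`. -/
def intertwiningSpace : Submodule ℂ (W₁ →ₗ[ℂ] ℂ → (W₂ →ₗ[ℂ] W₃)) where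
  carrier := {𝒴 | IsIntertwining A M₁ M₂ M₃ 𝒴}
  zero_mem' := ⟨fun _ _ => ⟨0, by simp⟩, by simp, by simp⟩
  add_mem' := by
    intro 𝒴 𝒵 h k
    refine ⟨fun w₁ w₂ => ?_, fun v w₁ w₂ r p q => ?_, fun w₁ n => ?_⟩
    · obtain ⟨N, hN⟩ := h.truncation w₁ w₂
      obtain ⟨K, hK⟩ := k.truncation w₁ w₂
      refine ⟨max N K, fun n hn => ?_⟩
      simp [hN n (le_trans (le_max_left _ _) hn), hK n (le_trans (le_max_right _ _) hn)]
    · have e := congrArg₂ (· + ·) (h.jacobi v w₁ w₂ r p q) (k.jacobi v w₁ w₂ r p q)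
      simp only [LinearMap.add_apply, Pi.add_apply, map_add, smul_add]
      rw [finsum_add_distrib (VertexTheory.finite_support₁ h _ _ _ _ _)
          (VertexTheory.finite_support₁ k _ _ _ _ _),
        finsum_add_distrib (VertexTheory.finite_support₂ 𝒴 _ _ _ _ _ _)
          (VertexTheory.finite_support₂ 𝒵 _ _ _ _ _ _),
        finsum_add_distrib (VertexTheory.finite_support₃ 𝒴 _ _ _ _ _ _)
          (VertexTheory.finite_support₃ 𝒵 _ _ _ _ _ _), ← e]
      abel
    · simp only [LinearMap.add_apply, Pi.add_apply, h.derivative, k.derivative, smul_add]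
  smul_mem' := by
    intro c 𝒴 h
    refine ⟨fun w₁ w₂ => ?_, fun v w₁ w₂ r p q => ?_, fun w₁ n => ?_⟩
    · obtain ⟨N, hN⟩ := h.truncation w₁ w₂
      exact ⟨N, fun n hn => by simp [hN n hn]⟩
    · have e := congrArg (c • ·) (h.jacobi v w₁ w₂ r p q)
      simp only [smul_sub, smul_finsum, smul_comm c] at e
      simpa only [LinearMap.smul_apply, Pi.smul_apply, map_smul] using e
    · simp only [LinearMap.smul_apply, Pi.smul_apply, h.derivative, smul_comm c]

variable (A M₁ M₂ M₃) in
/-- The fusion rule `N^{W₃}_{W₁W₂}`: the dimension of the space of intertwining operators, as a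
cardinal. -/
noncomputable def fusionRule :=
  Module.rank ℂ (intertwiningSpace A M₁ M₂ M₃)

end Intertwining

/-! ### The contragredient module -/

namespace VertexTheory

theorem choose_zero_succ (i : ℕ) : Ring.choose (0 : ℤ) (i + 1) = 0 := by
  exact_mod_cast Ring.choose_natCast (R := ℤ) 0 (i + 1)

/-- An eigenvector lies in the corresponding summand of an eigenspace decomposition. -/
theorem mem_grade_of_eigen {ι W : Type*} [DecidableEq ι] [AddCommGroup W] [Module ℂ W]
    {g : ι → Submodule ℂ W} (hg : DirectSum.IsInternal g) (e : ι → ℂ)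
    (he : Function.Injective e) (L : Module.End ℂ W) (hL : ∀ i, ∀ w ∈ g i, L w = e i • w)
    (c : ι) (w : W) (hw : L w = e c • w) : w ∈ g c := by
  classical
  let _ := hg.chooseDecomposition
  have key : ∀ (T : Module.End ℂ W) (t : ι → ℂ), (∀ i, ∀ w ∈ g i, T w = t i • w) →
      ∀ (x : W) (i : ι), (DirectSum.decompose g (T x) i : W)
        = t i • (DirectSum.decompose g x i : W) := by
    intro T t hT x i
    induction x using DirectSum.Decomposition.inductionOn g with
    | zero => simp
    | @homogeneous j m =>
      rw [hT j m m.2, ← Submodule.coe_smul, DirectSum.decompose_coe, DirectSum.decompose_coe]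
      by_cases h : j = i
      · subst h; simp
      · simp [DirectSum.of_eq_of_ne _ _ _ (Ne.symm h)]
    | add x y hx hy => simp [hx, hy]
  have hz : ∀ i, i ≠ c → (DirectSum.decompose g w i : W) = 0 := by
    intro i hi
    have h1 := key L e hL w i
    have h3 := key (e c • (1 : Module.End ℂ W)) (fun _ => e c) (fun i w _ => by simp) w i
    have h2 : (e c - e i) • (DirectSum.decompose g w i : W) = 0 := by
      rw [sub_smul, sub_eq_zero, ← h1, ← h3, hw]; simp
    exact (smul_eq_zero.mp h2).resolve_left (sub_ne_zero.mpr fun h => hi (he h.symm))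
  rw [← DirectSum.sum_support_decompose g w]
  refine Submodule.sum_mem _ fun i _ => ?_
  by_cases h : i = c
  · subst h; exact (DirectSum.decompose g w i).2
  · rw [hz i h]; exact Submodule.zero_mem _

/-- The commutator of the modes `u₁` and `vₙ`. -/
theorem JacobiIdentity.comm_one {V W : Type*} [AddCommGroup V] [Module ℂ V] [AddCommGroup W]
    [Module ℂ W] {Y : V →ₗ[ℂ] VertexOperator ℂ V} {YW : V →ₗ[ℂ] VertexOperator ℂ W}
    (h : JacobiIdentity Y YW) (u v : V) (w : W) (n : ℤ) :
    ((YW u)[[(1 : ℤ)]]) (((YW v)[[n]]) w) = ((YW v)[[n]]) (((YW u)[[(1 : ℤ)]]) w)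
      + ((YW (((Y u)[[(0 : ℤ)]]) v))[[n + 1]]) w + ((YW (((Y u)[[(1 : ℤ)]]) v))[[n]]) w := by
  have e := h u v w 0 1 n
  have hc : ∀ i : ℕ, i ≠ 0 → Ring.choose (0 : ℤ) i = 0 := by
    intro i hi
    obtain ⟨j, rfl⟩ := Nat.exists_eq_succ_of_ne_zero hi
    exact choose_zero_succ j
  have hd : ∀ i : ℕ, i ∉ ({0, 1} : Finset ℕ) → Ring.choose (1 : ℤ) i = 0 := by
    intro i hi
    have h1 : 1 < i := by
      simp only [Finset.mem_insert, Finset.mem_singleton, not_or] at hi; omega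
    have h2 := Ring.choose_natCast (R := ℤ) 1 i
    rw [Nat.choose_eq_zero_of_lt h1] at h2
    exact_mod_cast h2
  rw [finsum_eq_single _ 0 (fun i hi => by simp [hc i hi]),
    finsum_eq_single _ 0 (fun i hi => by simp [hc i hi]),
    finsum_eq_sum_of_support_subset (s := {0, 1}) _ (by
      intro i hi
      by_contra hn
      exact hi (by simp [hd i (by simpa using hn)]))] at e
  simp at e
  rw [sub_eq_iff_eq_add] at e
  rw [e, show (1 : ℤ) + n = n + 1 by ring]
  abel

end VertexTheory

theorem VertexOperatorAlgebra.bijective_coeLinearMap {V : Type*} [AddCommGroup V] [Module ℂ V]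
    (A : VertexOperatorAlgebra V) : Function.Bijective (DirectSum.coeLinearMap A.grade) :=
  A.isInternal

/-- The mode `L(1)` of the conformal vector lowers weights by one. -/
theorem VertexOperatorAlgebra.L_one_mem {V : Type*} [AddCommGroup V] [Module ℂ V]
    (A : VertexOperatorAlgebra V) {h : ℤ} {v : V} (hv : v ∈ A.grade h) :
    ((A.Y A.ω)[[(2 : ℤ)]]) v ∈ A.grade (h - 1) := by
  refine VertexTheory.mem_grade_of_eigen A.isInternal (fun i : ℤ => (i : ℂ))
    Int.cast_injective _ A.L_zero (h - 1) _ ?_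
  have e := LinearMap.congr_fun (A.virasoro 0 1) v
  simp [A.L_zero h v hv] at e
  rw [sub_eq_iff_eq_add] at e
  simp only [e]
  push_cast
  module

theorem VertexOperatorAlgebra.L_one_pow_mem {V : Type*} [AddCommGroup V] [Module ℂ V]
    (A : VertexOperatorAlgebra V) {h : ℤ} {v : V} (hv : v ∈ A.grade h) (k : ℕ) :
    (((A.Y A.ω)[[(2 : ℤ)]]) ^ k) v ∈ A.grade (h - k) := by
  induction k with
  | zero => simpa using hv
  | succ k ih =>
    rw [pow_succ', Module.End.mul_apply]
    have := A.L_one_mem ih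
    rwa [show h - ((k + 1 : ℕ) : ℤ) = h - k - 1 by push_cast; ring]

namespace VModule

open VertexTheory

variable {V : Type*} [AddCommGroup V] [Module ℂ V] {A : VertexOperatorAlgebra V}
    {W : Type*} [AddCommGroup W] [Module ℂ W]

/-- The graded dual `W' = ⨁ₙ W_(n)^*`: the linear functionals on `W` that vanish on all but
finitely many weight spaces. -/
def gradedDual (M : VModule A W) : Submodule ℂ (Module.Dual ℂ W) where
  carrier := {f | {n : ℂ | ∃ w ∈ M.grade n, f w ≠ 0}.Finite}
  zero_mem' := by simp
  add_mem' := by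
    intro f g hf hg
    refine (hf.union hg).subset ?_
    rintro n ⟨w, hw, h⟩
    by_contra! hn
    simp only [Set.mem_union, Set.mem_ofPred_eq, not_or, not_exists, not_and, not_not] at hn
    exact h (by simp [hn.1 w hw, hn.2 w hw])
  smul_mem' := by
    intro c f hf
    refine hf.subset ?_
    rintro n ⟨w, hw, h⟩
    exact ⟨w, hw, fun h0 => h (by simp [h0])⟩

/-- The mode `v ↦ vₘ` of the vertex operators, as a linear map. -/
noncomputable def mode (M : VModule A W) (m : ℤ) : V →ₗ[ℂ] Module.End ℂ W :=
  LinearMap.proj m ∘ₗ VertexOperator.ncoeff ∘ₗ M.Y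

/-- The coefficient of `x⁻ⁿ⁻¹` in `Y(e^{xL(1)} (-x⁻²)^{L(0)} v, x⁻¹)` for `v ∈ V_(h)`, that is
`(-1)ʰ ∑ₖ (1/k!) (L(1)ᵏ v)_{2h-k-n-2}`.  The sum is finite: `L(1)ᵏ v` has weight `h - k`. -/
noncomputable def oppositeModeHom (M : VModule A W) (n h : ℤ) : A.grade h →ₗ[ℂ] Module.End ℂ W :=
  ((-1 : ℂ) ^ h) • ∑ᶠ k : ℕ, ((k.factorial : ℂ)⁻¹) •
    (M.mode (2 * h - k - n - 2) ∘ₗ (((A.Y A.ω)[[(2 : ℤ)]]) ^ k) ∘ₗ (A.grade h).subtype)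

/-- The coefficient of `x⁻ⁿ⁻¹` in `Y(e^{xL(1)} (-x⁻²)^{L(0)} v, x⁻¹)` for all `v ∈ V`. -/
noncomputable def oppositeMode (M : VModule A W) (n : ℤ) : V →ₗ[ℂ] Module.End ℂ W :=
  DirectSum.toModule ℂ ℤ (Module.End ℂ W) (M.oppositeModeHom n) ∘ₗ
    (LinearEquiv.ofBijective (DirectSum.coeLinearMap A.grade) A.bijective_coeLinearMap).symm.toLinearMap

/-- For `v` of weight `h`, the mode `vₙ` shifts weights by `h - n - 1`. -/
theorem mode_mem (M : VModule A W) {h : ℤ} {v : V} (hv : v ∈ A.grade h) (n : ℤ) {m : ℂ} {w : W}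
    (hw : w ∈ M.grade m) : ((M.Y v)[[n]]) w ∈ M.grade (m + h - n - 1) := by
  refine VertexTheory.mem_grade_of_eigen M.isInternal id Function.injective_id _ M.L_zero _ _ ?_
  rw [M.jacobi.comm_one, M.L_zero m w hw, A.L_zero h v hv, M.derivative]
  simp
  module

theorem oppositeModeHom_mem (M : VModule A W) (n h : ℤ) (v : A.grade h) {m : ℂ} {w : W}
    (hw : w ∈ M.grade m) : M.oppositeModeHom n h v w ∈ M.grade (m - h + n + 1) := by
  rw [oppositeModeHom, LinearMap.smul_apply, LinearMap.smul_apply]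
  refine Submodule.smul_mem _ _ ?_
  refine finsum_induction
    (fun T : A.grade h →ₗ[ℂ] Module.End ℂ W => T v w ∈ M.grade (m - h + n + 1))
    (Submodule.zero_mem _) (fun S T hS hT => Submodule.add_mem _ hS hT) (fun k => ?_)
  refine Submodule.smul_mem _ _ ?_
  have e := M.mode_mem (A.L_one_pow_mem v.2 k) (2 * h - k - n - 2) hw
  have e' : m + ((h - k : ℤ) : ℂ) - ((2 * h - k - n - 2 : ℤ) : ℂ) - 1 = m - h + n + 1 := by
    push_cast
    ring
  rw [e'] at e
  exact e

theorem oppositeMode_apply_of_mem (M : VModule A W) (n : ℤ) {h : ℤ} (v : A.grade h) :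
    M.oppositeMode n v = M.oppositeModeHom n h v := by
  have e : (LinearEquiv.ofBijective (DirectSum.coeLinearMap A.grade) A.bijective_coeLinearMap).symm (v : V)
      = DirectSum.lof ℂ ℤ (fun i => A.grade i) h v := by
    rw [LinearEquiv.symm_apply_eq]
    simp
  rw [oppositeMode, LinearMap.comp_apply, LinearEquiv.coe_coe, e, DirectSum.toModule_lof]

theorem grade_induction (A : VertexOperatorAlgebra V) {P : V → Prop} (h0 : P 0)
    (hadd : ∀ u v, P u → P v → P (u + v)) (hom : ∀ (h : ℤ) (v : A.grade h), P v) (v : V) :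
    P v := by
  let _ := A.isInternal.chooseDecomposition
  induction v using DirectSum.Decomposition.inductionOn A.grade with
  | zero => exact h0
  | homogeneous m => exact hom _ m
  | add x y hx hy => exact hadd x y hx hy

theorem dualMap_oppositeMode_mem (M : VModule A W) (n : ℤ) (v : V) {f : Module.Dual ℂ W}
    (hf : f ∈ M.gradedDual) : (M.oppositeMode n v).dualMap f ∈ M.gradedDual := by
  induction v using grade_induction A with
  | h0 =>
    have e : (M.oppositeMode n 0).dualMap f = 0 := by ext w; simp
    rw [e]
    exact Submodule.zero_mem _
  | hadd u v hu hv =>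
    have e : (M.oppositeMode n (u + v)).dualMap f
        = (M.oppositeMode n u).dualMap f + (M.oppositeMode n v).dualMap f := by
      ext w; simp
    rw [e]
    exact Submodule.add_mem _ hu hv
  | hom h v =>
    have hinj : Function.Injective fun m : ℂ => m - h + n + 1 := fun a b hab => by simpa using hab
    refine (hf.preimage hinj.injOn).subset ?_
    rintro m ⟨w, hw, hne⟩
    rw [LinearMap.dualMap_apply, oppositeMode_apply_of_mem] at hne
    exact ⟨_, M.oppositeModeHom_mem n h v hw, hne⟩

/-- Lower truncation of the contragredient vertex operators. -/
theorem dualMap_oppositeMode_eq_zero (M : VModule A W) (v : V) {f : Module.Dual ℂ W}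
    (hf : f ∈ M.gradedDual) : ∃ N : ℤ, ∀ n, N ≤ n → (M.oppositeMode n v).dualMap f = 0 := by
  induction v using grade_induction A with
  | h0 => exact ⟨0, fun n _ => by ext w; simp⟩
  | hadd u v hu hv =>
    obtain ⟨N, hN⟩ := hu
    obtain ⟨K, hK⟩ := hv
    refine ⟨max N K, fun n hn => ?_⟩
    have e : (M.oppositeMode n (u + v)).dualMap f
        = (M.oppositeMode n u).dualMap f + (M.oppositeMode n v).dualMap f := by
      ext w; simp
    rw [e, hN n (le_trans (le_max_left _ _) hn), hK n (le_trans (le_max_right _ _) hn), add_zero]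
  | hom h v =>
    obtain ⟨B, hB⟩ := M.lower_bounded
    obtain ⟨C, hC⟩ := (hf.image Complex.re).bddAbove
    refine ⟨⌈C - B + h⌉, fun n hn => ?_⟩
    have hn' : C - B + h ≤ n := (Int.le_ceil _).trans (by exact_mod_cast hn)
    let _ := M.isInternal.chooseDecomposition
    ext w
    induction w using DirectSum.Decomposition.inductionOn M.grade with
    | zero => simp
    | @homogeneous m w =>
      by_contra hne
      rw [LinearMap.dualMap_apply, oppositeMode_apply_of_mem] at hne
      have h1 := hC ⟨_, ⟨_, M.oppositeModeHom_mem n h v w.2, hne⟩, rfl⟩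
      have h2 : B ≤ m.re := by
        by_contra hlt
        have hw : (w : W) = 0 := (Submodule.mem_bot ℂ).mp (hB m (not_le.mp hlt) ▸ w.2)
        exact hne (by rw [hw]; simp)
      simp at h1
      linarith
    | add x y hx hy => simpa using congrArg₂ (· + ·) hx hy

/-- The contragredient vertex operator `Y'(v, x)` on `W'`:
`⟨Y'(v, x)f, w⟩ = ⟨f, Y(e^{xL(1)} (-x⁻²)^{L(0)} v, x⁻¹)w⟩`. -/
noncomputable def contragredientY (M : VModule A W) (v : V) : VertexOperator ℂ M.gradedDual :=
  VertexOperator.of_coeff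
    (fun y => ((M.oppositeMode (-y - 1) v).dualMap).restrict
      (fun _ hf => M.dualMap_oppositeMode_mem (-y - 1) v hf))
    (fun f => by
      obtain ⟨N, hN⟩ := M.dualMap_oppositeMode_eq_zero v f.2
      refine ⟨-N - 1, fun y hy => ?_⟩
      by_contra hlt
      exact hy (Subtype.ext (hN (-y - 1) (by omega))))

theorem contragredientY_ncoeff (M : VModule A W) (v : V) (n : ℤ) (f : M.gradedDual) (w : W) :
    ((((M.contragredientY v)[[n]]) f : M.gradedDual) : Module.Dual ℂ W) w
      = (f : Module.Dual ℂ W) (M.oppositeMode n v w) := by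
  rw [contragredientY, VertexOperator.ncoeff_of_coeff]
  simp

/-- The contragredient module `W'` of `W`, with `W'_(n) = W_(n)^*`. -/
noncomputable def contragredient (M : VModule A W) : VModuleData V M.gradedDual where
  grade n := Submodule.comap M.gradedDual.subtype
    (⨅ (m : ℂ) (_ : m ≠ n), (M.grade m).dualAnnihilator)
  Y :=
    { toFun := M.contragredientY
      map_add' := fun u v => by
        apply HVertexOperator.coeff_inj
        funext y
        ext f w
        have e := fun v => M.contragredientY_ncoeff v (-y - 1) f w
        simp only [VertexOperator.coeff_eq_ncoeff, map_add] at e ⊢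
        simp [e]
      map_smul' := fun c v => by
        apply HVertexOperator.coeff_inj
        funext y
        ext f w
        have e := fun v => M.contragredientY_ncoeff v (-y - 1) f w
        simp only [VertexOperator.coeff_eq_ncoeff, map_smul] at e ⊢
        simp [e] }

end VModule

/-- The fusion-rule number `N_{W₁W₂W₃} = N^{W₃'}_{W₁W₂}` of three modules. -/
noncomputable def fusionNumber {V W₁ W₂ W₃ : Type*} [AddCommGroup V] [Module ℂ V]
    [AddCommGroup W₁] [Module ℂ W₁] [AddCommGroup W₂] [Module ℂ W₂] [AddCommGroup W₃]
    [Module ℂ W₃] {A : VertexOperatorAlgebra V} (M₁ : VModule A W₁) (M₂ : VModule A W₂)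
    (M₃ : VModule A W₃) :=
  fusionRule A M₁.toVModuleData M₂.toVModuleData M₃.contragredient

/-! The fusion number is the dimension of a space of three-point conformal blocks on the projective
line, and Möbius transformations permute the three points.

Let `𝒴` be an intertwining operator of type W₃' over W₁ W₂. Its value at x = 1 is the trilinear form
t(w₁, w₂, w₃) = ⟨𝒴(w₁, 1)w₂, w₃⟩. The Jacobi identity for ω and the `L(-1)`-derivative property show
that vectors of weights a, b, c pair to a multiple of the single power x^(c-a-b)
(`isExpansion_evalOne`). So t determines `𝒴`, and no branch of the logarithm is needed. On
homogeneous vectors the Jacobi identity says that, for f = xᵖ(x - 1)ʳ, the action of f·v expanded at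
∞, minus that at 0, equals that at 1. This is the condition defining `conformalBlocks`. Conversely,
a form satisfying it spreads out to an intertwining operator, and the derivative property comes back
from the condition for ω and f = x (`conformalBlocks_translation`). Hence `fusionNumber_eq_rank`. As
W₃ itself enters t, the three modules play parallel roles and no double contragredient occurs.

The substitutions x ↦ 1 - x and x ↦ 1/x generate the group permuting 0, 1, ∞. They act on forms
through the changes of local coordinate at the three points, that is, through `e^{πi L(0)}` and
`e^{L(1)}` (`swapFirst`, `swapLast`). That they preserve the residue condition rests on the
conjugation formulas `expLOne_mode` and `expLOne_oppositeMode`, and on the fact that forming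
opposite operators is an involution. These maps need not square to the identity: each is injective,
and injections in both directions equate the ranks, finite or not. -/

open Finset.HasAntidiagonal (antidiagonal mem_antidiagonal)

namespace VertexTheory

/-! ### Binomial coefficients -/

/-- The binomial coefficient `C(p, i)`, the coefficient of `xⁱ` in `(1 + x)ᵖ`. -/
noncomputable def binom (p : ℤ) (i : ℕ) : ℂ := ((Ring.choose p i : ℤ) : ℂ)

/-- The signed binomial coefficient `(-1)ⁱ C(p, i)`, the coefficient of `xⁱ` in `(1 - x)ᵖ`. -/
noncomputable def altBinom (p : ℤ) (i : ℕ) : ℂ := (-1 : ℂ) ^ i * (Ring.choose p i : ℤ)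

theorem altBinom_eq (p : ℤ) (i : ℕ) : altBinom p i = (-1 : ℂ) ^ i * binom p i := rfl

theorem binom_eq_altBinom (p : ℤ) (i : ℕ) : binom p i = (-1 : ℂ) ^ i * altBinom p i := by
  rw [altBinom_eq, ← mul_assoc, ← mul_pow]; simp

@[simp] theorem binom_zero_right (p : ℤ) : binom p 0 = 1 := by simp [binom]

@[simp] theorem altBinom_zero_right (p : ℤ) : altBinom p 0 = 1 := by simp [altBinom]

theorem binom_zero_left {i : ℕ} (hi : i ≠ 0) : binom 0 i = 0 := by
  obtain ⟨j, rfl⟩ := Nat.exists_eq_succ_of_ne_zero hi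
  simp [binom, choose_zero_succ j]

theorem altBinom_zero_left {i : ℕ} (hi : i ≠ 0) : altBinom 0 i = 0 := by
  rw [altBinom_eq, binom_zero_left hi, mul_zero]

theorem binom_natCast (n i : ℕ) : binom n i = (n.choose i : ℂ) := by
  rw [binom, Ring.choose_natCast]; simp

theorem binom_succ (p : ℤ) (k : ℕ) : binom (p + 1) (k + 1) = binom p k + binom p (k + 1) := by
  simp [binom, Ring.choose_succ_succ]

theorem succ_mul_binom_succ (p : ℤ) (k : ℕ) :
    ((k : ℂ) + 1) * binom p (k + 1) = (p - k) * binom p k := by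
  have h := Ring.choose_smul_choose p (Nat.le_succ k)
  rw [Nat.succ_eq_add_one, Nat.add_sub_cancel_left, Ring.choose_one_right,
    Nat.choose_succ_self_right, nsmul_eq_mul] at h
  have h2 := congrArg (Int.cast : ℤ → ℂ) h
  push_cast at h2
  simp only [binom]
  rw [h2]; ring

theorem binom_eq_neg_one_pow_mul (p : ℤ) (k : ℕ) :
    binom p k = (-1 : ℂ) ^ k * binom (k - p - 1) k := by
  have h := Ring.choose_neg (-p) k
  rw [neg_neg] at h
  simp only [binom]
  rw [h, show -p + (k : ℤ) - 1 = k - p - 1 by ring]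
  simp [Units.smul_def, Int.negOnePow]

theorem vandermonde (p q : ℤ) (k : ℕ) :
    binom (p + q) k = ∑ x ∈ antidiagonal k, binom p x.1 * binom q x.2 := by
  simp [binom, Ring.add_choose_eq k (Commute.all p q)]

/-- The coefficient of `yᵏ` in `∑ᵢ (-1)ⁱ C(p, i) yⁱ (1 + y)^{X - i} = (1 + y)^{X - p}`. -/
theorem sum_altBinom_mul_binom (p X : ℤ) (k : ℕ) :
    ∑ x ∈ antidiagonal k, altBinom p x.1 * binom (X - x.1) x.2 = binom (X - p) k := by
  rw [binom_eq_neg_one_pow_mul (X - p), show (k : ℤ) - (X - p) - 1 = p + (k - X - 1) by ring,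
    vandermonde, Finset.mul_sum]
  refine Finset.sum_congr rfl fun x hx => ?_
  have hk : x.1 + x.2 = k := mem_antidiagonal.mp hx
  -- Upper negation makes the upper argument k - X - 1, the same for every term, so Vandermonde
  -- applies.
  rw [binom_eq_neg_one_pow_mul (X - x.1), altBinom_eq, ← hk, pow_add,
    show (x.2 : ℤ) - (X - x.1) - 1 = ((x.1 + x.2 : ℕ) : ℤ) - X - 1 by push_cast; ring]
  ring

/-! ### Locally finite sums -/

section Finsum

variable {X Y : Type*} [AddCommGroup X] [AddCommGroup Y]

theorem finsum_antidiagonal (f : ℕ → ℕ → X)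
    (hf : (Function.support fun p : ℕ × ℕ => f p.1 p.2).Finite) :
    ∑ᶠ i, ∑ᶠ j, f i j = ∑ᶠ k, ∑ p ∈ antidiagonal k, f p.1 p.2 := by
  rw [← finsum_curry (fun p : ℕ × ℕ => f p.1 p.2) hf]
  rw [finsum_eq_sum_of_support_subset (s := hf.toFinset) _ (by simp),
    ← finsum_sum_filter (fun p : ℕ × ℕ => p.1 + p.2)]
  refine finsum_congr fun k => ?_
  refine Finset.sum_subset (fun p hp => ?_) (fun p hp hn => ?_)
  · simpa using (Finset.mem_filter.mp hp).2
  · by_contra h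
    exact hn (by simpa [h] using hp)

theorem finite_support_of_eventually (f : ℕ → ℕ → X) (h₁ : ∃ J, ∀ j, J ≤ j → ∀ m, f j m = 0)
    (h₂ : ∀ j, ∃ N, ∀ m, N ≤ m → f j m = 0) :
    (Function.support fun p : ℕ × ℕ => f p.1 p.2).Finite := by
  obtain ⟨J, hJ⟩ := h₁
  choose N hN using h₂
  refine ((Finset.range J).biUnion
    fun j => (Finset.range (N j)).image (Prod.mk j)).finite_toSet.subset ?_
  rintro ⟨j, m⟩ h
  have hj : j < J := not_le.mp fun hj => h (hJ j hj m)
  have hm : m < N j := not_le.mp fun hm => h (hN j m hm)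
  simp [hj, hm]

theorem finsum_eq_sum_range {f : ℕ → X} {N : ℕ} (h : ∀ i, N ≤ i → f i = 0) :
    ∑ᶠ i, f i = ∑ i ∈ Finset.range N, f i :=
  finsum_eq_sum_of_support_subset _ fun i hi => by
    simpa using not_le.mp fun hN => hi (h i hN)

variable [Module ℂ X] [Module ℂ Y]

theorem finite_support_of_eventually_add {B : ℕ → X} (hB : ∃ N, ∀ b, N ≤ b → B b = 0)
    (c : ℕ → ℕ → ℂ) : (Function.support fun p : ℕ × ℕ => c p.1 p.2 • B (p.1 + p.2)).Finite := by
  obtain ⟨N, hN⟩ := hB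
  exact finite_support_of_eventually (fun i j => c i j • B (i + j))
    ⟨N, fun j hj m => by simp [hN (j + m) (by omega)]⟩
    fun j => ⟨N, fun m hm => by simp [hN (j + m) (by omega)]⟩

theorem finsum_smul_finsum_add {B : ℕ → X} (hB : ∃ N, ∀ b, N ≤ b → B b = 0)
    (c d : ℕ → ℂ) (e : ℕ → ℕ → ℂ)
    (h : ∀ k, ∑ p ∈ antidiagonal k, c p.1 * e p.1 p.2 = d k) :
    ∑ᶠ i, c i • ∑ᶠ j, e i j • B (i + j) = ∑ᶠ k, d k • B k := by
  simp only [smul_finsum, smul_smul]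
  rw [finsum_antidiagonal (fun i j => (c i * e i j) • B (i + j))
    (finite_support_of_eventually_add hB fun i j => c i * e i j)]
  refine finsum_congr fun k => ?_
  rw [← h k, Finset.sum_smul]
  refine Finset.sum_congr rfl fun p hp => ?_
  rw [mem_antidiagonal.mp hp]

/-- With yᵏ standing for `B k`, this is (1 - y/(1 + y))ᵖ (1 + y)^Z = (1 + y)^(Z - p). -/
theorem finsum_altBinom_smul_finsum_binom {B : ℕ → X} (hB : ∃ N, ∀ b, N ≤ b → B b = 0) (p Z : ℤ) :
    ∑ᶠ i, altBinom p i • ∑ᶠ j, binom (Z - i) j • B (i + j) = ∑ᶠ k, binom (Z - p) k • B k :=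
  finsum_smul_finsum_add hB _ _ (fun i j => binom (Z - i) j) fun k => sum_altBinom_mul_binom p Z k

theorem map_finsum_of_bound (g : X →ₗ[ℂ] Y) {f : ℕ → X} (h : ∃ N, ∀ i, N ≤ i → f i = 0) :
    g (∑ᶠ i, f i) = ∑ᶠ i, g (f i) :=
  map_finsum g (finite_support_of_bound f h)

/-- The sum of a pointwise finite family of linear maps. -/
noncomputable def locallyFiniteSum (B : ℕ → X →ₗ[ℂ] Y) (hB : ∀ w, ∃ N, ∀ i, N ≤ i → B i w = 0) :
    X →ₗ[ℂ] Y where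
  toFun w := ∑ᶠ i, B i w
  map_add' u v := by
    simp only [map_add]
    exact finsum_add_distrib (finite_support_of_bound _ (hB u)) (finite_support_of_bound _ (hB v))
  map_smul' c v := by simp [smul_finsum]

end Finsum

/-! ### Exponentials of locally nilpotent operators -/

section LocallyNilpotent

variable {X : Type*} [AddCommGroup X] [Module ℂ X]

/-- The divided power `Lᵏ / k!`. -/
noncomputable def divPow (L : Module.End ℂ X) (k : ℕ) : Module.End ℂ X :=
  (k.factorial : ℂ)⁻¹ • L ^ k

@[simp] theorem divPow_zero (L : Module.End ℂ X) : divPow L 0 = 1 := by simp [divPow]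

theorem mul_divPow (L : Module.End ℂ X) (k : ℕ) :
    L * divPow L k = ((k : ℂ) + 1) • divPow L (k + 1) := by
  have : ((k : ℂ) + 1) ≠ 0 := by exact_mod_cast k.succ_ne_zero
  rw [divPow, divPow, mul_smul_comm, smul_smul, pow_succ', Nat.factorial_succ]
  congr 1
  push_cast
  field_simp

theorem divPow_mul_divPow (L : Module.End ℂ X) (j k : ℕ) :
    divPow L k * divPow L j = ((j + k).choose j : ℂ) • divPow L (j + k) := by
  rw [divPow, divPow, divPow, smul_mul_smul_comm, ← pow_add, smul_smul, add_comm k j]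
  congr 1
  have h2 : ((j + k).choose j : ℂ) * j.factorial * k.factorial = (j + k).factorial := by
    rw [Nat.choose_symm_add]
    exact_mod_cast Nat.add_choose_mul_factorial_mul_factorial j k
  have hj : (j.factorial : ℂ) ≠ 0 := by exact_mod_cast j.factorial_ne_zero
  have hk : (k.factorial : ℂ) ≠ 0 := by exact_mod_cast k.factorial_ne_zero
  have hjk : ((j + k).factorial : ℂ) ≠ 0 := by exact_mod_cast (j + k).factorial_ne_zero
  rw [← mul_inv, inv_eq_iff_eq_inv, mul_inv, inv_inv, ← h2]
  have hc : ((j + k).choose j : ℂ) ≠ 0 := by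
    exact_mod_cast (Nat.choose_pos (Nat.le_add_right j k)).ne'
  field_simp

/-- Leibniz rule for divided powers: split the factor k + 1 = i + j of each term `f i j` on the
right and reindex the two halves. -/
theorem sum_antidiagonal_succ_smul (k : ℕ) (f : ℕ → ℕ → X) :
    ∑ p ∈ antidiagonal k,
      (((p.1 : ℂ) + 1) • f (p.1 + 1) p.2 + ((p.2 : ℂ) + 1) • f p.1 (p.2 + 1))
      = ((k : ℂ) + 1) • ∑ p ∈ antidiagonal (k + 1), f p.1 p.2 := by
  have h : ((k : ℂ) + 1) • ∑ p ∈ antidiagonal (k + 1), f p.1 p.2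
      = ∑ p ∈ antidiagonal (k + 1), (p.1 : ℂ) • f p.1 p.2
        + ∑ p ∈ antidiagonal (k + 1), (p.2 : ℂ) • f p.1 p.2 := by
    rw [Finset.smul_sum, ← Finset.sum_add_distrib]
    refine Finset.sum_congr rfl fun p hp => ?_
    rw [← add_smul]
    congr 1
    exact_mod_cast (mem_antidiagonal.mp hp).symm
  rw [h, Finset.Nat.sum_antidiagonal_succ (f := fun p => (p.1 : ℂ) • f p.1 p.2),
    Finset.Nat.sum_antidiagonal_succ' (f := fun p => (p.2 : ℂ) • f p.1 p.2),
    Finset.sum_add_distrib]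
  simp

/-- If `[L, Q_k] = (k + 1) Q_{k+1}`, so that `Q_k = ad(L)ᵏ Q_0 / k!`, then
`(Lᵏ / k!) Q_0 = ∑_{a + l = k} Q_a Lˡ / l!`. -/
theorem divPow_mul_of_commutator {L : Module.End ℂ X} {Q : ℕ → Module.End ℂ X}
    (hQ : ∀ k, L * Q k = Q k * L + ((k : ℂ) + 1) • Q (k + 1)) (k : ℕ) :
    divPow L k * Q 0 = ∑ p ∈ antidiagonal k, Q p.1 * divPow L p.2 := by
  induction k with
  | zero => simp
  | succ k ih =>
    have hk : ((k : ℂ) + 1) ≠ 0 := by exact_mod_cast k.succ_ne_zero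
    apply smul_right_injective _ hk
    simp only
    rw [← smul_mul_assoc, ← mul_divPow, mul_assoc, ih, Finset.mul_sum,
      ← sum_antidiagonal_succ_smul k fun a l => Q a * divPow L l]
    refine Finset.sum_congr rfl fun p _ => ?_
    rw [← mul_assoc, hQ, add_mul, mul_assoc, mul_divPow, mul_smul_comm, smul_mul_assoc, add_comm]

/-- A locally nilpotent operator. -/
def LocallyNilpotent (L : Module.End ℂ X) : Prop := ∀ w, ∃ N, ∀ k, N ≤ k → (L ^ k) w = 0

theorem LocallyNilpotent.divPow {L : Module.End ℂ X} (hL : LocallyNilpotent L) (w : X) :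
    ∃ N, ∀ k, N ≤ k → divPow L k w = 0 := by
  obtain ⟨N, hN⟩ := hL w
  exact ⟨N, fun k hk => by simp [VertexTheory.divPow, hN k hk]⟩

/-- The exponential of a locally nilpotent operator. -/
noncomputable def LocallyNilpotent.exp {L : Module.End ℂ X} (hL : LocallyNilpotent L) :
    Module.End ℂ X :=
  locallyFiniteSum (VertexTheory.divPow L) hL.divPow

theorem LocallyNilpotent.exp_apply {L : Module.End ℂ X} (hL : LocallyNilpotent L) (w : X) :
    hL.exp w = ∑ᶠ k, VertexTheory.divPow L k w := rfl

/-- The exponential is unipotent: if Lᴺ⁺¹ w = 0, then e^L w - w is a sum of vectors killed by Lᴺ, so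
induction on N applies. Surjectivity is what makes precomposition with e^L injective on forms. -/
theorem LocallyNilpotent.exp_surjective {L : Module.End ℂ X} (hL : LocallyNilpotent L) :
    Function.Surjective hL.exp := by
  have key : ∀ (N : ℕ) (w : X), (L ^ N) w = 0 → w ∈ LinearMap.range hL.exp := by
    intro N
    induction N with
    | zero => intro w hw; simp at hw; simp [hw]
    | succ N ih =>
      intro w hw
      have hz : ∀ k, N + 1 ≤ k → VertexTheory.divPow L k w = 0 := by
        intro k hk
        obtain ⟨l, rfl⟩ := Nat.exists_eq_add_of_le' hk
        simp only [VertexTheory.divPow, LinearMap.smul_apply]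
        rw [pow_add, Module.End.mul_apply, hw]
        simp
      have h1 : hL.exp w = ∑ k ∈ Finset.range N, VertexTheory.divPow L (k + 1) w + w := by
        rw [hL.exp_apply, finsum_eq_sum_range hz, Finset.sum_range_succ']
        simp
      have h2 : ∑ k ∈ Finset.range N, VertexTheory.divPow L (k + 1) w ∈ LinearMap.range hL.exp := by
        refine Submodule.sum_mem _ fun k _ => ih _ ?_
        simp only [VertexTheory.divPow, LinearMap.smul_apply, map_smul]
        rw [← Module.End.mul_apply, ← pow_add, show N + (k + 1) = k + (N + 1) by ring, pow_add,
          Module.End.mul_apply, hw]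
        simp
      have h3 : w = hL.exp w - ∑ k ∈ Finset.range N, VertexTheory.divPow L (k + 1) w := by
        rw [h1]; abel
      rw [h3]
      exact Submodule.sub_mem _ ⟨w, rfl⟩ h2
  intro w
  obtain ⟨N, hN⟩ := hL w
  exact key N w (hN N le_rfl)

/-- `e^L Q_0 = (∑_a Q_a) e^L` when `Q_a = ad(L)ᵃ Q_0 / a!`. -/
theorem LocallyNilpotent.exp_comm {L : Module.End ℂ X} (hL : LocallyNilpotent L)
    {Q : ℕ → Module.End ℂ X} (hQ : ∀ k, L * Q k = Q k * L + ((k : ℂ) + 1) • Q (k + 1))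
    (hfin : ∀ w, ∃ N, ∀ a, N ≤ a → Q a w = 0) (w : X) :
    hL.exp (Q 0 w) = ∑ᶠ a, Q a (hL.exp w) := by
  have h1 : ∀ k, VertexTheory.divPow L k (Q 0 w)
      = ∑ p ∈ antidiagonal k, Q p.1 (VertexTheory.divPow L p.2 w) := by
    intro k
    have := LinearMap.congr_fun (divPow_mul_of_commutator hQ k) w
    simpa [LinearMap.sum_apply] using this
  obtain ⟨N, hN⟩ := hL.divPow w
  rw [hL.exp_apply, finsum_congr h1,
    ← finsum_antidiagonal fun a l => Q a (VertexTheory.divPow L l w)]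
  · refine finsum_congr fun a => ?_
    rw [hL.exp_apply, map_finsum_of_bound _ (hL.divPow w)]
  · choose K hK using hfin
    refine finite_support_of_eventually (fun a l => Q a (VertexTheory.divPow L l w)) ?_
      fun j => ⟨N, fun m hm => by simp [hN m hm]⟩
    -- Only the vectors Lˡw/l! with l < N matter, so the sum of their individual bounds serves for
    -- all of them.
    refine ⟨∑ l ∈ Finset.range N, K (VertexTheory.divPow L l w), fun j hj m => ?_⟩
    by_cases hm : N ≤ m
    · simp [hN m hm]
    · refine hK _ j (le_trans ?_ hj)
      exact Finset.single_le_sum (f := fun l => K (VertexTheory.divPow L l w))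
        (fun _ _ => Nat.zero_le _) (Finset.mem_range.mpr (not_le.mp hm))

end LocallyNilpotent

end VertexTheory

/-! ### Commutators with `L(1)` and conjugation by `e^{L(1)}` -/

namespace VertexTheory

/-- The commutator of the modes `u₂` and `vₙ`. -/
theorem JacobiIdentity.comm_two {V W : Type*} [AddCommGroup V] [Module ℂ V] [AddCommGroup W]
    [Module ℂ W] {Y : V →ₗ[ℂ] VertexOperator ℂ V} {YW : V →ₗ[ℂ] VertexOperator ℂ W}
    (h : JacobiIdentity Y YW) (u v : V) (w : W) (n : ℤ) :
    ((YW u)[[(2 : ℤ)]]) (((YW v)[[n]]) w) = ((YW v)[[n]]) (((YW u)[[(2 : ℤ)]]) w)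
      + ((YW (((Y u)[[(0 : ℤ)]]) v))[[n + 2]]) w
      + (2 : ℂ) • ((YW (((Y u)[[(1 : ℤ)]]) v))[[n + 1]]) w
      + ((YW (((Y u)[[(2 : ℤ)]]) v))[[n]]) w := by
  have e := h u v w 0 2 n
  have hc : ∀ i : ℕ, i ≠ 0 → Ring.choose (0 : ℤ) i = 0 := by
    intro i hi
    obtain ⟨j, rfl⟩ := Nat.exists_eq_succ_of_ne_zero hi
    exact choose_zero_succ j
  have h2 : ∀ i : ℕ, Ring.choose (2 : ℤ) i = (Nat.choose 2 i : ℤ) := fun i =>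
    Ring.choose_natCast (R := ℤ) 2 i
  rw [finsum_eq_single _ 0 (fun i hi => by simp [hc i hi]),
    finsum_eq_single _ 0 (fun i hi => by simp [hc i hi]),
    finsum_eq_sum_range (N := 3) (fun i hi => by
      rw [h2, Nat.choose_eq_zero_of_lt (by omega)]; simp)] at e
  simp [Finset.sum_range_succ, h2] at e
  rw [sub_eq_iff_eq_add] at e
  rw [e, show (2 : ℤ) + n = n + 2 by ring, show n + 2 - 1 = n + 1 by ring]
  abel

end VertexTheory

open VertexTheory

/-- The operator `L(1)` on a vertex operator algebra. -/
noncomputable def VertexOperatorAlgebra.LOne {V : Type*} [AddCommGroup V] [Module ℂ V]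
    (A : VertexOperatorAlgebra V) : Module.End ℂ V := (A.Y A.ω)[[(2 : ℤ)]]

section

variable {V : Type*} [AddCommGroup V] [Module ℂ V] (A : VertexOperatorAlgebra V)

theorem VertexOperatorAlgebra.exists_LOne_pow_eq_zero (h : ℤ) :
    ∃ K : ℕ, ∀ k, K ≤ k → ∀ v ∈ A.grade h, (A.LOne ^ k) v = 0 := by
  obtain ⟨N, hN⟩ := A.lower_bounded
  refine ⟨(h - N).toNat + 1, fun k hk v hv => ?_⟩
  have := A.L_one_pow_mem hv k
  rw [hN _ (by omega)] at this
  exact (Submodule.mem_bot ℂ).mp this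

theorem VertexOperatorAlgebra.exists_divPow_eq_zero (h : ℤ) :
    ∃ K : ℕ, ∀ k, K ≤ k → ∀ v ∈ A.grade h, divPow A.LOne k v = 0 := by
  obtain ⟨K, hK⟩ := A.exists_LOne_pow_eq_zero h
  exact ⟨K, fun k hk v hv => by simp [divPow, hK k hk v hv]⟩

theorem VertexOperatorAlgebra.divPow_mem {h : ℤ} {v : V} (hv : v ∈ A.grade h) (k : ℕ) :
    divPow A.LOne k v ∈ A.grade (h - k) :=
  Submodule.smul_mem _ _ (A.L_one_pow_mem hv k)

theorem VertexOperatorAlgebra.LOne_divPow (k : ℕ) (v : V) :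
    A.LOne (divPow A.LOne k v) = ((k : ℂ) + 1) • divPow A.LOne (k + 1) v :=
  LinearMap.congr_fun (mul_divPow A.LOne k) v

end

namespace VModule

variable {V : Type*} [AddCommGroup V] [Module ℂ V] {A : VertexOperatorAlgebra V}
    {W : Type*} [AddCommGroup W] [Module ℂ W] (M : VModule A W)

/-- The operator `L(1)` on a module. -/
noncomputable def LOne : Module.End ℂ W := (M.Y A.ω)[[(2 : ℤ)]]

/-- In the commutator formula for ω₂ and vₙ, the term (L(-1)v)_{n+2} contributes -(n + 2) and the
term 2(L(0)v)_{n+1} contributes 2h to the coefficient of v_{n+1}. -/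
theorem LOne_mul_mode {h : ℤ} {v : V} (hv : v ∈ A.grade h) (n : ℤ) :
    M.LOne * M.mode n v = M.mode n v * M.LOne + M.mode n (A.LOne v)
      + (2 * (h : ℂ) - n - 2) • M.mode (n + 1) v := by
  ext w
  have e := M.jacobi.comm_two A.ω v w n
  rw [A.L_zero h v hv, M.derivative] at e
  simp only [map_smul] at e
  refine e.trans ?_
  rw [show n + 2 - 1 = n + 1 by ring]
  simp only [LinearMap.add_apply, LinearMap.smul_apply, Pi.smul_apply]
  change M.mode n v (M.LOne w) + (-((n + 2 : ℤ) : ℂ)) • M.mode (n + 1) v w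
    + (2 : ℂ) • (h : ℂ) • M.mode (n + 1) v w + M.mode n (A.LOne v) w
    = M.mode n v (M.LOne w) + M.mode n (A.LOne v) w
      + (2 * (h : ℂ) - n - 2) • M.mode (n + 1) v w
  push_cast
  module

theorem LOne_mem {m : ℂ} {w : W} (hw : w ∈ M.grade m) : M.LOne w ∈ M.grade (m - 1) := by
  have e := M.mode_mem A.omega_mem 2 hw
  rwa [show m + ((2 : ℤ) : ℂ) - ((2 : ℤ) : ℂ) - 1 = m - 1 by push_cast; ring] at e

theorem LOne_pow_mem {m : ℂ} {w : W} (hw : w ∈ M.grade m) (k : ℕ) :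
    (M.LOne ^ k) w ∈ M.grade (m - k) := by
  induction k with
  | zero => simpa using hw
  | succ k ih =>
    rw [pow_succ', Module.End.mul_apply]
    have := M.LOne_mem ih
    rwa [show m - ((k + 1 : ℕ) : ℂ) = m - k - 1 by push_cast; ring]

theorem hom_induction {P : W → Prop} (h0 : P 0) (hadd : ∀ u v, P u → P v → P (u + v))
    (hom : ∀ a : ℂ, ∀ w ∈ M.grade a, P w) (w : W) : P w := by
  let _ := M.isInternal.chooseDecomposition
  induction w using DirectSum.Decomposition.inductionOn M.grade with
  | zero => exact h0
  | homogeneous m => exact hom _ m m.2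
  | add x y hx hy => exact hadd x y hx hy

theorem locallyNilpotent_LOne : LocallyNilpotent M.LOne := by
  intro w
  induction w using M.hom_induction with
  | h0 => exact ⟨0, by simp⟩
  | hadd u v hu hv =>
    obtain ⟨N, hN⟩ := hu
    obtain ⟨K, hK⟩ := hv
    exact ⟨max N K, fun k hk => by
      simp [hN k (le_trans (le_max_left _ _) hk), hK k (le_trans (le_max_right _ _) hk)]⟩
  | hom a w hw =>
    obtain ⟨B, hB⟩ := M.lower_bounded
    refine ⟨⌈a.re - B⌉₊ + 1, fun k hk => ?_⟩
    have := M.LOne_pow_mem hw k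
    rw [hB _ ?_] at this
    · exact (Submodule.mem_bot ℂ).mp this
    · have h1 : a.re - B ≤ ⌈a.re - B⌉₊ := Nat.le_ceil _
      have h2 : ((⌈a.re - B⌉₊ + 1 : ℕ) : ℝ) ≤ k := by exact_mod_cast hk
      push_cast at h2
      simp
      linarith

/-- The operator `e^{L(1)}`. -/
noncomputable def expLOne : Module.End ℂ W := M.locallyNilpotent_LOne.exp

theorem expLOne_surjective : Function.Surjective M.expLOne :=
  M.locallyNilpotent_LOne.exp_surjective

theorem mode_eventually (v : V) (n : ℤ) (w : W) : ∃ N : ℕ, ∀ i : ℕ, N ≤ i → M.mode (n + i) v w = 0 := by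
  obtain ⟨N, hN⟩ := (M.Y v).eventually_ncoeff_eq_zero w
  exact ⟨(N - n).toNat, fun i hi => hN _ (by omega)⟩

/-- Conjugation of a mode by `e^{L(1)}`. -/
theorem expLOne_mode {h : ℤ} {v : V} (hv : v ∈ A.grade h) (n : ℤ) (w : W) :
    M.expLOne (M.mode n v w) = ∑ᶠ j : ℕ, ∑ᶠ m : ℕ, binom (2 * h - j - n - 2) m •
      M.mode (n + m) (divPow A.LOne j v) (M.expLOne w) := by
  set F : ℕ → ℕ → Module.End ℂ W := fun j m =>
    binom (2 * h - j - n - 2) m • M.mode (n + m) (divPow A.LOne j v) with hF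
  have hfin : ∀ w, (Function.support fun p : ℕ × ℕ => F p.1 p.2 w).Finite := by
    intro w
    refine finite_support_of_eventually (fun j m => F j m w) ?_ fun j => ?_
    · obtain ⟨K, hK⟩ := A.exists_divPow_eq_zero h
      exact ⟨K, fun j hj m => by simp [hF, hK j hj v hv]⟩
    · obtain ⟨N, hN⟩ := M.mode_eventually (divPow A.LOne j v) n w
      exact ⟨N, fun m hm => by simp [hF, hN m hm]⟩
  -- The part of total degree k is the candidate for ad(L(1))ᵏ vₙ / k!, and `exp_comm` asks for
  -- exactly this recursion.
  have hcomm : ∀ k, M.LOne * (∑ p ∈ antidiagonal k, F p.1 p.2)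
      = (∑ p ∈ antidiagonal k, F p.1 p.2) * M.LOne
        + ((k : ℂ) + 1) • ∑ p ∈ antidiagonal (k + 1), F p.1 p.2 := by
    intro k
    have hJ : ∀ j m, M.LOne * F j m = F j m * M.LOne
        + (((j : ℂ) + 1) • (binom (2 * h - j - n - 2) m •
            M.mode (n + m) (divPow A.LOne (j + 1) v))
          + ((2 * h - j - n - 2 - m - j) * binom (2 * h - j - n - 2) m) •
            M.mode (n + (m + 1 : ℕ)) (divPow A.LOne j v)) := by
      intro j m
      simp only [hF]
      rw [mul_smul_comm, M.LOne_mul_mode (A.divPow_mem hv j), A.LOne_divPow, map_smul,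
        show n + ((m + 1 : ℕ) : ℤ) = n + m + 1 by push_cast; ring, smul_mul_assoc]
      push_cast
      module
    rw [Finset.mul_sum, Finset.sum_mul, ← sum_antidiagonal_succ_smul, ← sub_eq_iff_eq_add',
      ← Finset.sum_sub_distrib]
    simp only [hJ, add_sub_cancel_left]
    rw [← sub_eq_zero, ← Finset.sum_sub_distrib]
    -- The two terms of [L(1), F j m] differ from (j + 1) F (j + 1) m and (m + 1) F j (m + 1) by `u
    -- j m` and `-g j m`. Pascal's rule gives `u j (m + 1) = g (j + 1) m`, so these errors cancel
    -- along the antidiagonal.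
    set g : ℕ → ℕ → Module.End ℂ W := fun j m => ((j : ℂ) * binom (2 * h - j - n - 2) m) •
      M.mode (n + (m + 1 : ℕ)) (divPow A.LOne j v) with hg
    set u : ℕ → ℕ → Module.End ℂ W := fun j m => (((j : ℂ) + 1) *
      (binom (2 * h - j - n - 2) m - binom (2 * h - (j + 1 : ℕ) - n - 2) m)) •
        M.mode (n + m) (divPow A.LOne (j + 1) v) with hu
    have hug : ∀ j m, u j (m + 1) = g (j + 1) m := by
      intro j m
      simp only [hu, hg]
      rw [show 2 * h - (j : ℤ) - n - 2 = 2 * h - (j + 1 : ℕ) - n - 2 + 1 by push_cast; ring,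
        binom_succ]
      push_cast
      module
    have hu0 : ∀ j, u j 0 = 0 := fun j => by simp [hu]
    have hg0 : ∀ m, g 0 m = 0 := fun m => by simp [hg]
    calc _ = ∑ p ∈ antidiagonal k, (u p.1 p.2 - g p.1 p.2) := by
          refine Finset.sum_congr rfl fun p _ => ?_
          simp only [hu, hg, hF]
          have e := succ_mul_binom_succ (2 * h - p.1 - n - 2) p.2
          rw [smul_smul ((p.2 : ℂ) + 1), e]
          push_cast
          module
      _ = 0 := by
          rw [Finset.sum_sub_distrib]
          cases k with
          | zero => simp [hu0, hg0]
          | succ k =>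
            rw [Finset.Nat.sum_antidiagonal_succ' (f := fun p => u p.1 p.2),
              Finset.Nat.sum_antidiagonal_succ (f := fun p => g p.1 p.2)]
            simp [hu0, hg0, hug]
  have key := M.locallyNilpotent_LOne.exp_comm
    (Q := fun k => ∑ p ∈ antidiagonal k, F p.1 p.2) hcomm ?_ w
  · have h0 : (∑ p ∈ antidiagonal 0, F p.1 p.2) = M.mode n v := by
      simp [hF]
    simp only [h0] at key
    refine key.trans ?_
    rw [finsum_antidiagonal _ (hfin (M.expLOne w))]
    exact finsum_congr fun k => LinearMap.sum_apply _ _ _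
  · intro w
    refine ⟨∑ p ∈ (hfin w).toFinset, (p.1 + p.2 + 1), fun a ha => ?_⟩
    rw [LinearMap.sum_apply]
    refine Finset.sum_eq_zero fun p hp => ?_
    by_contra hne
    have h1 := Finset.single_le_sum (f := fun p : ℕ × ℕ => p.1 + p.2 + 1)
      (fun _ _ => Nat.zero_le _) ((hfin w).mem_toFinset.mpr hne)
    have h2 := mem_antidiagonal.mp hp
    omega

theorem oppositeMode_eq_sum {h : ℤ} {v : V} (hv : v ∈ A.grade h) {K : ℕ}
    (hK : ∀ k, K ≤ k → divPow A.LOne k v = 0) (n : ℤ) :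
    M.oppositeMode n v = (-1 : ℂ) ^ h • ∑ k ∈ Finset.range K,
      M.mode (2 * h - k - n - 2) (divPow A.LOne k v) := by
  rw [M.oppositeMode_apply_of_mem n (⟨v, hv⟩ : A.grade h), oppositeModeHom, LinearMap.smul_apply]
  congr 1
  -- The sum defining `oppositeModeHom` is one of linear maps on the whole of V_(h), so evaluating
  -- it termwise needs a bound uniform in the vector, not just the bound K for v.
  obtain ⟨K', hK'⟩ := A.exists_LOne_pow_eq_zero h
  have := map_finsum_of_bound (LinearMap.applyₗ (⟨v, hv⟩ : A.grade h))
    (f := fun k : ℕ => ((k.factorial : ℂ)⁻¹) •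
    (M.mode (2 * h - k - n - 2) ∘ₗ (((A.Y A.ω)[[(2 : ℤ)]]) ^ k) ∘ₗ (A.grade h).subtype))
    ⟨K', fun k hk => by
      ext1 u
      have := hK' k hk u u.2
      rw [VertexOperatorAlgebra.LOne] at this
      simp [this]⟩
  refine this.trans ?_
  have hs : ∀ k : ℕ, LinearMap.applyₗ (⟨v, hv⟩ : A.grade h) (((k.factorial : ℂ)⁻¹) •
      (M.mode (2 * h - k - n - 2) ∘ₗ (((A.Y A.ω)[[(2 : ℤ)]]) ^ k) ∘ₗ (A.grade h).subtype))
      = M.mode (2 * h - k - n - 2) (divPow A.LOne k v) := by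
    intro k
    simp [divPow, VertexOperatorAlgebra.LOne]
  rw [finsum_congr hs]
  exact finsum_eq_sum_range fun k hk => by simp [hK k hk]

/-- The derivative property `[Y°(v, x), L(1)] = d/dx Y°(v, x)` of the opposite vertex operators. -/
theorem LOne_mul_oppositeMode {h : ℤ} {v : V} (hv : v ∈ A.grade h) (n : ℤ) :
    M.LOne * M.oppositeMode n v = M.oppositeMode n v * M.LOne
      + (n : ℂ) • M.oppositeMode (n - 1) v := by
  obtain ⟨K, hK⟩ := A.exists_divPow_eq_zero h
  have hK' : ∀ k, K ≤ k → divPow A.LOne k v = 0 := fun k hk => hK k hk v hv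
  rw [M.oppositeMode_eq_sum hv hK' n, M.oppositeMode_eq_sum hv hK' (n - 1), mul_smul_comm,
    smul_mul_assoc, smul_comm (n : ℂ), ← smul_add, Finset.mul_sum, Finset.sum_mul]
  congr 1
  rw [← sub_eq_iff_eq_add', ← Finset.sum_sub_distrib]
  -- The first bracket telescopes in k. Its boundary terms vanish: the coefficient is 0 at k = 0,
  -- and L(1)ᴷv = 0 at k = K.
  have hs : ∀ k : ℕ, M.LOne * M.mode (2 * h - k - n - 2) (divPow A.LOne k v)
      - M.mode (2 * h - k - n - 2) (divPow A.LOne k v) * M.LOne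
      = (((k + 1 : ℕ) : ℂ) • M.mode (2 * h - (k + 1 : ℕ) - (n - 1) - 2) (divPow A.LOne (k + 1) v)
        - (k : ℂ) • M.mode (2 * h - k - (n - 1) - 2) (divPow A.LOne k v))
        + (n : ℂ) • M.mode (2 * h - k - (n - 1) - 2) (divPow A.LOne k v) := by
    intro k
    rw [M.LOne_mul_mode (A.divPow_mem hv k), A.LOne_divPow, map_smul,
      show 2 * h - ((k + 1 : ℕ) : ℤ) - (n - 1) - 2 = 2 * h - k - n - 2 by push_cast; ring,
      show 2 * h - (k : ℤ) - (n - 1) - 2 = 2 * h - k - n - 2 + 1 by ring]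
    push_cast
    module
  simp only [hs]
  rw [Finset.sum_add_distrib, Finset.sum_range_sub (fun k : ℕ =>
    (k : ℂ) • M.mode (2 * h - k - (n - 1) - 2) (divPow A.LOne k v)), Finset.smul_sum]
  simp [hK' K le_rfl]

theorem oppositeMode_eventually {h : ℤ} {v : V} (hv : v ∈ A.grade h) (n : ℤ) (w : W) :
    ∃ N : ℕ, ∀ i : ℕ, N ≤ i → M.oppositeMode (n - i) v w = 0 := by
  obtain ⟨K, hK⟩ := A.exists_divPow_eq_zero h
  have hK' : ∀ k, K ≤ k → divPow A.LOne k v = 0 := fun k hk => hK k hk v hv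
  choose N hN using fun k : ℕ => M.mode_eventually (divPow A.LOne k v) (2 * h - k - n - 2) w
  refine ⟨∑ k ∈ Finset.range K, N k, fun i hi => ?_⟩
  rw [M.oppositeMode_eq_sum hv hK']
  simp only [LinearMap.smul_apply, LinearMap.sum_apply]
  rw [Finset.sum_eq_zero, smul_zero]
  intro k hk
  rw [show 2 * h - (k : ℤ) - (n - i) - 2 = 2 * h - k - n - 2 + i by ring]
  exact hN k i (le_trans (Finset.single_le_sum (fun _ _ => Nat.zero_le _) hk) hi)

/-- Conjugation of an opposite mode by `e^{L(1)}`. -/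
theorem expLOne_oppositeMode {h : ℤ} {v : V} (hv : v ∈ A.grade h) (n : ℤ) (w : W) :
    M.expLOne (M.oppositeMode n v w)
      = ∑ᶠ k : ℕ, binom n k • M.oppositeMode (n - k) v (M.expLOne w) := by
  have key := M.locallyNilpotent_LOne.exp_comm
    (Q := fun k => binom n k • M.oppositeMode (n - k) v) ?_ ?_ w
  · simpa [expLOne] using key
  · intro k
    rw [smul_smul, succ_mul_binom_succ, mul_smul_comm, M.LOne_mul_oppositeMode hv, smul_mul_assoc,
      show n - ((k + 1 : ℕ) : ℤ) = n - k - 1 by push_cast; ring]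
    push_cast
    module
  · intro w
    obtain ⟨N, hN⟩ := M.oppositeMode_eventually hv n w
    exact ⟨N, fun a ha => by simp [hN a ha]⟩

/-- Forming opposite vertex operators is an involution. -/
theorem sum_oppositeMode_divPow {h : ℤ} {v : V} (hv : v ∈ A.grade h) {K : ℕ}
    (hK : ∀ k, K ≤ k → divPow A.LOne k v = 0) (n : ℤ) :
    (-1 : ℂ) ^ h • ∑ j ∈ Finset.range K,
      M.oppositeMode (2 * h - j - n - 2) (divPow A.LOne j v) = M.mode n v := by
  have hjk : ∀ j k, divPow A.LOne k (divPow A.LOne j v)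
      = ((j + k).choose j : ℂ) • divPow A.LOne (j + k) v := fun j k =>
    LinearMap.congr_fun (divPow_mul_divPow A.LOne j k) v
  set B : ℕ → Module.End ℂ W := fun s => M.mode (n - s) (divPow A.LOne s v) with hB
  have hBz : ∃ N, ∀ s, N ≤ s → B s = 0 := ⟨K, fun s hs => by simp [hB, hK s hs]⟩
  have h1 : ∀ j : ℕ, M.oppositeMode (2 * h - j - n - 2) (divPow A.LOne j v)
      = ∑ᶠ k, ((-1 : ℂ) ^ h * ((-1) ^ j * (j + k).choose j)) • B (j + k) := by
    intro j
    rw [M.oppositeMode_eq_sum (A.divPow_mem hv j) (K := K)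
      (fun k hk => by rw [hjk, hK _ (by omega), smul_zero]),
      finsum_eq_sum_range (N := K) (fun k hk => by simp [hB, hK (j + k) (by omega)]),
      Finset.smul_sum]
    refine Finset.sum_congr rfl fun k _ => ?_
    rw [hjk, map_smul, smul_smul, hB]
    have e1 : 2 * (h - j) - k - (2 * h - j - n - 2) - 2 = n - ((j + k : ℕ) : ℤ) := by
      push_cast; ring
    have e2 : (-1 : ℂ) ^ (h - (j : ℤ)) = (-1) ^ h * (-1) ^ j := by
      rw [zpow_sub₀ (by norm_num), zpow_natCast, div_eq_mul_inv, ← inv_pow]; norm_num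
    rw [e1, e2]
    ring_nf
  have h2 : ∑ j ∈ Finset.range K, M.oppositeMode (2 * h - j - n - 2) (divPow A.LOne j v)
      = ∑ᶠ j : ℕ, ∑ᶠ k, ((-1 : ℂ) ^ h * ((-1) ^ j * (j + k).choose j)) • B (j + k) := by
    rw [finsum_eq_sum_range (N := K)]
    · exact Finset.sum_congr rfl fun j _ => h1 j
    · intro j hj
      rw [← h1, hK j hj, map_zero]
  -- The alternating sum of the binomial coefficients C(k, j) vanishes unless k = 0, so the double
  -- sum collapses to `B 0`.
  have h3 : ∀ k, ∑ p ∈ antidiagonal k,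
      ((-1 : ℂ) ^ h * ((-1) ^ p.1 * (p.1 + p.2).choose p.1)) • B (p.1 + p.2)
      = ((-1 : ℂ) ^ h * if k = 0 then 1 else 0) • B k := by
    intro k
    have e := congrArg (Int.cast : ℤ → ℂ) (Int.alternating_sum_range_choose (n := k))
    push_cast at e
    rw [← e, ← Finset.Nat.sum_antidiagonal_eq_sum_range_succ_mk
      (fun p => (-1 : ℂ) ^ p.1 * k.choose p.1), Finset.mul_sum, Finset.sum_smul]
    exact Finset.sum_congr rfl fun p hp => by rw [mem_antidiagonal.mp hp]
  rw [h2, finsum_antidiagonal _ (finite_support_of_eventually_add hBz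
    fun j k => (-1 : ℂ) ^ h * ((-1) ^ j * (j + k).choose j)), finsum_congr h3,
    finsum_eq_single _ 0 fun k hk => by simp [hk], smul_smul]
  simp [hB, ← mul_zpow]

end VModule

/-! ### Weight decompositions, `e^{πi L(0)}` and series of modes -/

namespace VModule

variable {V : Type*} [AddCommGroup V] [Module ℂ V] {A : VertexOperatorAlgebra V}
    {W : Type*} [AddCommGroup W] [Module ℂ W] (M : VModule A W)
    {X : Type*} [AddCommGroup X] [Module ℂ X]

theorem bijective_coeLinearMap : Function.Bijective (DirectSum.coeLinearMap M.grade) :=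
  M.isInternal

/-- The linear map on `W` that agrees with `F a` on the weight space `W_(a)`. -/
noncomputable def assemble : (ℂ → W →ₗ[ℂ] X) →ₗ[ℂ] W →ₗ[ℂ] X where
  toFun F := DirectSum.toModule ℂ ℂ X (fun a => F a ∘ₗ (M.grade a).subtype) ∘ₗ
    (LinearEquiv.ofBijective (DirectSum.coeLinearMap M.grade)
      M.bijective_coeLinearMap).symm.toLinearMap
  map_add' F G := by
    rw [← LinearMap.add_comp]
    congr 1
    ext a w
    simp
  map_smul' c F := by
    rw [RingHom.id_apply, ← LinearMap.smul_comp]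
    congr 1
    ext a w
    simp

theorem assemble_of_mem (F : ℂ → W →ₗ[ℂ] X) {a : ℂ} {w : W} (hw : w ∈ M.grade a) :
    M.assemble F w = F a w := by
  have e : (LinearEquiv.ofBijective (DirectSum.coeLinearMap M.grade)
      M.bijective_coeLinearMap).symm w
      = DirectSum.lof ℂ ℂ (fun i => M.grade i) a ⟨w, hw⟩ := by
    rw [LinearEquiv.symm_apply_eq]
    simp
  change DirectSum.toModule ℂ ℂ X _ (LinearEquiv.symm _ w) = _
  rw [e, DirectSum.toModule_lof]
  rfl

theorem hom_ext {f g : W →ₗ[ℂ] X} (h : ∀ a, ∀ w ∈ M.grade a, f w = g w) : f = g := by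
  ext w
  induction w using M.hom_induction with
  | h0 => simp
  | hadd u v hu hv => simp [hu, hv]
  | hom a w hw => exact h a w hw

/-- An operator `e^{πi L(0)}`. -/
noncomputable def signOp : Module.End ℂ W :=
  M.assemble fun a => Complex.exp (Real.pi * Complex.I * a) • LinearMap.id

theorem signOp_of_mem {a : ℂ} {w : W} (hw : w ∈ M.grade a) :
    M.signOp w = Complex.exp (Real.pi * Complex.I * a) • w := by
  rw [signOp, M.assemble_of_mem _ hw]; rfl

theorem signOp_surjective : Function.Surjective M.signOp := by
  intro w
  induction w using M.hom_induction with
  | h0 => exact ⟨0, map_zero _⟩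
  | hadd u v hu hv =>
    obtain ⟨x, rfl⟩ := hu
    obtain ⟨y, rfl⟩ := hv
    exact ⟨x + y, map_add _ _ _⟩
  | hom a w hw =>
    refine ⟨(Complex.exp (Real.pi * Complex.I * a))⁻¹ • w, ?_⟩
    rw [map_smul, M.signOp_of_mem hw, smul_smul, inv_mul_cancel₀ (Complex.exp_ne_zero _), one_smul]

/-- `e^{πi L(0)}` commutes up to a sign with operators of integral weight. -/
theorem signOp_apply_of_shift {T : Module.End ℂ W} {k : ℤ}
    (hT : ∀ a, ∀ w ∈ M.grade a, T w ∈ M.grade (a + k)) (w : W) :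
    M.signOp (T w) = (-1 : ℂ) ^ k • T (M.signOp w) := by
  have h : M.signOp ∘ₗ T = (-1 : ℂ) ^ k • (T ∘ₗ M.signOp) := by
    refine M.hom_ext fun a w hw => ?_
    simp only [LinearMap.comp_apply, LinearMap.smul_apply]
    rw [M.signOp_of_mem (hT a w hw), M.signOp_of_mem hw, map_smul, smul_smul, mul_add,
      Complex.exp_add, mul_comm (_ ^ k), mul_comm (_ * Complex.I) (k : ℂ), Complex.exp_int_mul,
      Complex.exp_pi_mul_I]
  exact LinearMap.congr_fun h w

theorem mode_apply_mem {h : ℤ} {v : V} (hv : v ∈ A.grade h) (n : ℤ) {m : ℂ} {w : W}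
    (hw : w ∈ M.grade m) : M.mode n v w ∈ M.grade (m + h - n - 1) :=
  M.mode_mem hv n hw

theorem signOp_mode {h : ℤ} {v : V} (hv : v ∈ A.grade h) (n : ℤ) (w : W) :
    M.signOp (M.mode n v w) = (-1 : ℂ) ^ (h - n - 1) • M.mode n v (M.signOp w) := by
  refine M.signOp_apply_of_shift (fun a w hw => ?_) w
  have e := M.mode_mem hv n hw
  rwa [show a + (h : ℂ) - n - 1 = a + ((h - n - 1 : ℤ) : ℂ) by push_cast; ring] at e

theorem oppositeMode_mem {h : ℤ} {v : V} (hv : v ∈ A.grade h) (n : ℤ) {m : ℂ} {w : W}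
    (hw : w ∈ M.grade m) : M.oppositeMode n v w ∈ M.grade (m - h + n + 1) := by
  rw [M.oppositeMode_apply_of_mem n (⟨v, hv⟩ : A.grade h)]
  exact M.oppositeModeHom_mem n h ⟨v, hv⟩ hw

theorem signOp_oppositeMode {h : ℤ} {v : V} (hv : v ∈ A.grade h) (n : ℤ) (w : W) :
    M.signOp (M.oppositeMode n v w)
      = (-1 : ℂ) ^ (n + 1 - h) • M.oppositeMode n v (M.signOp w) := by
  refine M.signOp_apply_of_shift (fun a w hw => ?_) w
  have e := M.oppositeMode_mem hv n hw
  rwa [show a - (h : ℂ) + n + 1 = a + ((n + 1 - h : ℤ) : ℂ) by push_cast; ring] at e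

/-- The locally finite sum `∑ᵢ cᵢ v_{n+i} w`. -/
noncomputable def modeSeries (v : V) (n : ℤ) (c : ℕ → ℂ) (w : W) : W :=
  ∑ᶠ i : ℕ, c i • M.mode (n + i) v w

/-- The locally finite sum `∑ᵢ cᵢ v°_{n-i} w` of opposite modes. -/
noncomputable def oppositeSeries (v : V) (n : ℤ) (c : ℕ → ℂ) (w : W) : W :=
  ∑ᶠ i : ℕ, c i • M.oppositeMode (n - i) v w

theorem modeSeries_bound (v : V) (n : ℤ) (c : ℕ → ℂ) (w : W) :
    ∃ N, ∀ i : ℕ, N ≤ i → c i • M.mode (n + i) v w = 0 := by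
  obtain ⟨N, hN⟩ := M.mode_eventually v n w
  exact ⟨N, fun i hi => by rw [hN i hi, smul_zero]⟩

theorem oppositeSeries_bound {h : ℤ} {v : V} (hv : v ∈ A.grade h) (n : ℤ) (c : ℕ → ℂ) (w : W) :
    ∃ N, ∀ i : ℕ, N ≤ i → c i • M.oppositeMode (n - i) v w = 0 := by
  obtain ⟨N, hN⟩ := M.oppositeMode_eventually hv n w
  exact ⟨N, fun i hi => by rw [hN i hi, smul_zero]⟩

theorem map_modeSeries (f : W →ₗ[ℂ] X) (v : V) (n : ℤ) (c : ℕ → ℂ) (w : W) :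
    f (M.modeSeries v n c w) = ∑ᶠ i : ℕ, c i • f (M.mode (n + i) v w) := by
  rw [modeSeries, map_finsum_of_bound f (M.modeSeries_bound v n c w)]
  simp

theorem map_oppositeSeries (f : W →ₗ[ℂ] X) {h : ℤ} {v : V} (hv : v ∈ A.grade h) (n : ℤ)
    (c : ℕ → ℂ) (w : W) :
    f (M.oppositeSeries v n c w) = ∑ᶠ i : ℕ, c i • f (M.oppositeMode (n - i) v w) := by
  rw [oppositeSeries, map_finsum_of_bound f (M.oppositeSeries_bound hv n c w)]
  simp

theorem neg_one_zpow_mul_altBinom (k : ℤ) (r : ℤ) (i : ℕ) :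
    (-1 : ℂ) ^ (k - i) * altBinom r i = (-1) ^ k * binom r i := by
  rw [binom_eq_altBinom, ← mul_assoc, zpow_sub₀ (by norm_num), zpow_natCast, div_eq_mul_inv,
    ← inv_pow]
  norm_num

theorem neg_one_zpow_mul_binom (k : ℤ) (r : ℤ) (i : ℕ) :
    (-1 : ℂ) ^ (k - i) * binom r i = (-1) ^ k * altBinom r i := by
  rw [altBinom_eq, ← mul_assoc, zpow_sub₀ (by norm_num), zpow_natCast, div_eq_mul_inv,
    ← inv_pow]
  norm_num

/-- Moving `e^{πi L(0)}` past v_{n+i} costs a sign alternating in i, which exchanges the expansions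
of (1 - x)ʳ and (1 + x)ʳ. The next two lemmas rest on the same sign. -/
theorem signOp_modeSeries_altBinom {h : ℤ} {v : V} (hv : v ∈ A.grade h) (n r : ℤ) (w : W) :
    M.signOp (M.modeSeries v n (altBinom r) w)
      = (-1 : ℂ) ^ (h - n - 1) • M.modeSeries v n (binom r) (M.signOp w) := by
  rw [map_modeSeries, modeSeries, smul_finsum]
  refine finsum_congr fun i => ?_
  rw [M.signOp_mode hv, smul_smul, smul_smul, ← neg_one_zpow_mul_altBinom, mul_comm]
  congr 3
  ring

theorem signOp_modeSeries_binom {h : ℤ} {v : V} (hv : v ∈ A.grade h) (n r : ℤ) (w : W) :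
    M.signOp (M.modeSeries v n (binom r) w)
      = (-1 : ℂ) ^ (h - n - 1) • M.modeSeries v n (altBinom r) (M.signOp w) := by
  rw [map_modeSeries, modeSeries, smul_finsum]
  refine finsum_congr fun i => ?_
  rw [M.signOp_mode hv, smul_smul, smul_smul, ← neg_one_zpow_mul_binom, mul_comm]
  congr 3
  ring

theorem signOp_oppositeSeries_binom {h : ℤ} {v : V} (hv : v ∈ A.grade h) (n r : ℤ) (w : W) :
    M.signOp (M.oppositeSeries v n (binom r) w)
      = (-1 : ℂ) ^ (n + 1 - h) • M.oppositeSeries v n (altBinom r) (M.signOp w) := by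
  rw [M.map_oppositeSeries _ hv, oppositeSeries, smul_finsum]
  refine finsum_congr fun i => ?_
  rw [M.signOp_oppositeMode hv, smul_smul, smul_smul, ← neg_one_zpow_mul_binom, mul_comm]
  congr 3
  ring

/-- On opposite modes `e^{L(1)}` acts as x ↦ x + 1, and this takes xⁿ(1 - 1/x)ʳ = xⁿ⁻ʳ(x - 1)ʳ to (x
+ 1)ⁿ⁻ʳxʳ = xⁿ(1 + 1/x)ⁿ⁻ʳ. -/
theorem expLOne_oppositeSeries {h : ℤ} {v : V} (hv : v ∈ A.grade h) (n r : ℤ) (w : W) :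
    M.expLOne (M.oppositeSeries v n (altBinom r) w)
      = M.oppositeSeries v n (binom (n - r)) (M.expLOne w) := by
  rw [M.map_oppositeSeries _ hv, oppositeSeries,
    ← finsum_altBinom_smul_finsum_binom (B := fun i : ℕ =>
      M.oppositeMode (n - i) v (M.expLOne w)) (M.oppositeMode_eventually hv n _)]
  refine finsum_congr fun i => ?_
  rw [M.expLOne_oppositeMode hv]
  congr 1
  refine finsum_congr fun j => ?_
  rw [show n - ((i + j : ℕ) : ℤ) = n - i - j by push_cast; ring]

/-- Conjugation by `e^{L(1)}` implements the change of variables `x ↦ 1/x` around `x = 1`. -/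
theorem expLOne_modeSeries {h : ℤ} {v : V} (hv : v ∈ A.grade h) {K : ℕ}
    (hK : ∀ k, K ≤ k → divPow A.LOne k v = 0) (n p : ℤ) (w : W) :
    M.expLOne (M.modeSeries v n (altBinom p) w) = ∑ j ∈ Finset.range K,
      M.modeSeries (divPow A.LOne j v) n (binom (2 * h - j - p - n - 2)) (M.expLOne w) := by
  have h1 : ∀ i : ℕ, altBinom p i • M.expLOne (M.mode (n + i) v w)
      = ∑ j ∈ Finset.range K, altBinom p i • ∑ᶠ m : ℕ, binom (2 * h - j - n - 2 - i) m •
        M.mode (n + (i + m : ℕ)) (divPow A.LOne j v) (M.expLOne w) := by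
    intro i
    rw [M.expLOne_mode hv, finsum_eq_sum_range (N := K), Finset.smul_sum]
    · refine Finset.sum_congr rfl fun j _ => ?_
      congr 1
      refine finsum_congr fun m => ?_
      rw [show n + ((i + m : ℕ) : ℤ) = n + i + m by push_cast; ring,
        show 2 * h - (j : ℤ) - n - 2 - i = 2 * h - j - (n + i) - 2 by ring]
    · intro j hj
      simp [hK j hj]
  rw [map_modeSeries, finsum_congr h1, finsum_sum_comm]
  · refine Finset.sum_congr rfl fun j _ => ?_
    rw [finsum_altBinom_smul_finsum_binom (B := fun i : ℕ =>
      M.mode (n + i) (divPow A.LOne j v) (M.expLOne w)) (M.mode_eventually _ n _), modeSeries]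
    rw [show 2 * h - (j : ℤ) - n - 2 - p = 2 * h - j - p - n - 2 by ring]
  · intro j _
    obtain ⟨N, hN⟩ := M.mode_eventually (divPow A.LOne j v) n (M.expLOne w)
    refine finite_support_of_bound _ ⟨N, fun i hi => ?_⟩
    rw [finsum_congr (g := fun _ => 0) fun m => by rw [hN _ (by omega), smul_zero] ]
    simp

/-- Term i is the involution `sum_oppositeMode_divPow` at n + i. Together with
`sum_modeSeries_divPow`, it exchanges the expansions at 0 and ∞ under x ↦ 1/x. -/
theorem sum_oppositeSeries_divPow {h : ℤ} {v : V} (hv : v ∈ A.grade h) {K : ℕ}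
    (hK : ∀ k, K ≤ k → divPow A.LOne k v = 0) (n : ℤ) (c : ℕ → ℂ) (w : W) :
    ∑ j ∈ Finset.range K, M.oppositeSeries (divPow A.LOne j v) (2 * h - j - n - 2) c w
      = (-1 : ℂ) ^ h • M.modeSeries v n c w := by
  simp only [oppositeSeries]
  rw [← finsum_sum_comm, modeSeries, smul_finsum]
  · refine finsum_congr fun i => ?_
    rw [← Finset.smul_sum, smul_comm, ← M.sum_oppositeMode_divPow hv hK, LinearMap.smul_apply,
      smul_smul ((-1 : ℂ) ^ h), ← mul_zpow]
    simp only [LinearMap.sum_apply]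
    norm_num
    congr 1
    refine Finset.sum_congr rfl fun j _ => ?_
    congr 3
    ring
  · intro j _
    exact finite_support_of_bound _ (M.oppositeSeries_bound (A.divPow_mem hv j) _ c w)

theorem sum_modeSeries_divPow {h : ℤ} {v : V} (hv : v ∈ A.grade h) {K : ℕ}
    (hK : ∀ k, K ≤ k → divPow A.LOne k v = 0) (n : ℤ) (c : ℕ → ℂ) (w : W) :
    ∑ j ∈ Finset.range K, M.modeSeries (divPow A.LOne j v) (2 * h - j - n - 2) c w
      = (-1 : ℂ) ^ h • M.oppositeSeries v n c w := by
  simp only [modeSeries]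
  rw [← finsum_sum_comm, oppositeSeries, smul_finsum]
  · refine finsum_congr fun i => ?_
    rw [← Finset.smul_sum, smul_comm, M.oppositeMode_eq_sum hv hK, LinearMap.smul_apply,
      smul_smul ((-1 : ℂ) ^ h), ← mul_zpow]
    simp only [LinearMap.sum_apply]
    norm_num
    congr 1
    refine Finset.sum_congr rfl fun j _ => ?_
    congr 3
    ring
  · intro j _
    exact finite_support_of_bound _ (M.modeSeries_bound _ _ c w)

end VModule

/-! ### Conformal blocks and their Möbius symmetries -/

namespace VModule

section ConformalBlocks

variable {V : Type*} [AddCommGroup V] [Module ℂ V] {A : VertexOperatorAlgebra V}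
  {W₁ W₂ W₃ : Type*} [AddCommGroup W₁] [Module ℂ W₁] [AddCommGroup W₂] [Module ℂ W₂]
  [AddCommGroup W₃] [Module ℂ W₃]
  (M₁ : VModule A W₁) (M₂ : VModule A W₂) (M₃ : VModule A W₃)

/-- The space of three-point conformal blocks: the trilinear forms on `W₁ × W₂ × W₃`, with the
modules at the points `1`, `0`, `∞`, satisfying the residue identity for every `v ∈ V_(h)` and every
function `xᵖ (x - 1)ʳ`. -/
noncomputable def conformalBlocks : Submodule ℂ (W₁ →ₗ[ℂ] W₂ →ₗ[ℂ] W₃ →ₗ[ℂ] ℂ) where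
  carrier := {t | ∀ (h : ℤ), ∀ v ∈ A.grade h, ∀ (r p : ℤ) (w₁ : W₁) (w₂ : W₂) (w₃ : W₃),
    t w₁ w₂ (M₃.oppositeSeries v (p + r) (altBinom r) w₃)
      - (-1 : ℂ) ^ r * t w₁ (M₂.modeSeries v p (altBinom r) w₂) w₃
      = t (M₁.modeSeries v r (binom p) w₁) w₂ w₃}
  zero_mem' := by intro h v _ r p w₁ w₂ w₃; simp
  add_mem' := by
    intro s t hs ht h v hv r p w₁ w₂ w₃
    simp only [LinearMap.add_apply]
    rw [← hs h v hv, ← ht h v hv]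
    ring
  smul_mem' := by
    intro c t ht h v hv r p w₁ w₂ w₃
    simp only [LinearMap.smul_apply, smul_eq_mul]
    rw [← ht h v hv]
    ring

/-- The map on trilinear forms induced by `x ↦ 1 - x`, exchanging `0` and `1`. -/
noncomputable def swapFirst :
    (W₁ →ₗ[ℂ] W₂ →ₗ[ℂ] W₃ →ₗ[ℂ] ℂ) →ₗ[ℂ] W₂ →ₗ[ℂ] W₁ →ₗ[ℂ] W₃ →ₗ[ℂ] ℂ where
  toFun t := LinearMap.mk₂ ℂ (fun w₂ w₁ =>
      t (M₁.signOp w₁) (M₂.signOp w₂) ∘ₗ M₃.signOp ∘ₗ M₃.expLOne)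
    (fun _ _ _ => by ext; simp) (fun _ _ _ => by ext; simp)
    (fun _ _ _ => by ext; simp) (fun _ _ _ => by ext; simp)
  map_add' _ _ := by ext; simp
  map_smul' _ _ := by ext; simp

theorem swapFirst_apply (t : W₁ →ₗ[ℂ] W₂ →ₗ[ℂ] W₃ →ₗ[ℂ] ℂ) (w₁ : W₁) (w₂ : W₂) (w₃ : W₃) :
    swapFirst M₁ M₂ M₃ t w₂ w₁ w₃
      = t (M₁.signOp w₁) (M₂.signOp w₂) (M₃.signOp (M₃.expLOne w₃)) := rfl

theorem swapFirst_injective : Function.Injective (swapFirst M₁ M₂ M₃) := by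
  intro s t hst
  ext w₁ w₂ w₃
  obtain ⟨w₁, rfl⟩ := M₁.signOp_surjective w₁
  obtain ⟨w₂, rfl⟩ := M₂.signOp_surjective w₂
  obtain ⟨w₃, rfl⟩ := M₃.signOp_surjective w₃
  obtain ⟨w₃, rfl⟩ := M₃.expLOne_surjective w₃
  rw [← swapFirst_apply, ← swapFirst_apply, hst]

/-- Under x ↦ 1 - x the coordinates at 0 and 1 change sign, whence `e^{πi L(0)}`, and z = 1/x
becomes -z/(1 - z), whence the extra `e^{L(1)}` at ∞. The function xᵖ(x - 1)ʳ becomes xʳ(x - 1)ᵖ up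
to sign, so the identity for t is used with r and p exchanged. -/
theorem swapFirst_mem {t : W₁ →ₗ[ℂ] W₂ →ₗ[ℂ] W₃ →ₗ[ℂ] ℂ} (ht : t ∈ conformalBlocks M₁ M₂ M₃) :
    swapFirst M₁ M₂ M₃ t ∈ conformalBlocks M₂ M₁ M₃ := by
  intro h v hv r p w₂ w₁ w₃
  simp only [swapFirst_apply]
  have e := ht h v hv p r (M₁.signOp w₁) (M₂.signOp w₂) (M₃.signOp (M₃.expLOne w₃))
  rw [M₃.expLOne_oppositeSeries hv, M₃.signOp_oppositeSeries_binom hv,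
    M₁.signOp_modeSeries_altBinom hv, M₂.signOp_modeSeries_binom hv, add_sub_cancel_right]
  simp only [map_smul, LinearMap.smul_apply, smul_eq_mul]
  rw [add_comm p r, ← e]
  have hn : (-1 : ℂ) ≠ 0 := by norm_num
  have hs : ∀ k : ℤ, (-1 : ℂ) ^ (-k) = (-1) ^ k := fun k => by
    rw [zpow_neg, ← inv_zpow]; norm_num
  have hm : ∀ k : ℤ, (-1 : ℂ) ^ k * (-1) ^ k = 1 := fun k => by
    rw [← mul_zpow]; norm_num
  simp only [sub_eq_add_neg, zpow_add₀ hn, hs, zpow_one]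
  have hp := hm p
  have hr := hm r
  grind

/-- The map on trilinear forms induced by `x ↦ 1 / x`, exchanging `0` and `∞`. -/
noncomputable def swapLast :
    (W₁ →ₗ[ℂ] W₂ →ₗ[ℂ] W₃ →ₗ[ℂ] ℂ) →ₗ[ℂ] W₁ →ₗ[ℂ] W₃ →ₗ[ℂ] W₂ →ₗ[ℂ] ℂ where
  toFun t := LinearMap.mk₂ ℂ (fun w₁ w₃ => (t (M₁.expLOne (M₁.signOp w₁))).flip w₃)
    (fun _ _ _ => by ext; simp) (fun _ _ _ => by ext; simp)
    (fun _ _ _ => by ext; simp) (fun _ _ _ => by ext; simp)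
  map_add' _ _ := by ext; simp
  map_smul' _ _ := by ext; simp

theorem swapLast_apply (t : W₁ →ₗ[ℂ] W₂ →ₗ[ℂ] W₃ →ₗ[ℂ] ℂ) (w₁ : W₁) (w₂ : W₂) (w₃ : W₃) :
    swapLast M₁ t w₁ w₃ w₂ = t (M₁.expLOne (M₁.signOp w₁)) w₂ w₃ := rfl

theorem swapLast_injective :
    Function.Injective (swapLast M₁ (W₂ := W₂) (W₃ := W₃)) := by
  intro s t hst
  ext w₁ w₂ w₃
  obtain ⟨w₁, rfl⟩ := M₁.expLOne_surjective w₁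
  obtain ⟨w₁, rfl⟩ := M₁.signOp_surjective w₁
  rw [← swapLast_apply, ← swapLast_apply, hst]

/-- Under x ↦ 1/x the coordinates x at 0 and 1/x at ∞ are exchanged, so w₂ and w₃ stay as they are.
The coordinate y = x - 1 at 1 becomes -y/(1 + y), whence `e^{L(1)} e^{πi L(0)}` on w₁. The vector v
changes as in the definition of Y', so the identities for all L(1)ʲv/j! have to be added up. -/
theorem swapLast_mem {t : W₁ →ₗ[ℂ] W₂ →ₗ[ℂ] W₃ →ₗ[ℂ] ℂ} (ht : t ∈ conformalBlocks M₁ M₂ M₃) :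
    swapLast M₁ t ∈ conformalBlocks M₁ M₃ M₂ := by
  intro h v hv r p w₁ w₃ w₂
  simp only [swapLast_apply]
  obtain ⟨K, hK⟩ := A.exists_divPow_eq_zero h
  have hK' : ∀ k, K ≤ k → divPow A.LOne k v = 0 := fun k hk => hK k hk v hv
  set u := M₁.expLOne (M₁.signOp w₁)
  -- Up to sign, xᵖ(x - 1)ʳ becomes x⁻ᵖ⁻ʳ(x - 1)ʳ; the transformation of v contributes x^(2h - j)
  -- and that of dx contributes x⁻².
  have e := Finset.sum_congr rfl fun (j : ℕ) (_ : j ∈ Finset.range K) =>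
    ht (h - j) (divPow A.LOne j v) (A.divPow_mem hv j) r (2 * h - j - p - r - 2) u w₂ w₃
  rw [Finset.sum_sub_distrib, ← Finset.mul_sum] at e
  have e₃ : ∑ j ∈ Finset.range K, t u w₂ (M₃.oppositeSeries (divPow A.LOne j v)
      (2 * h - j - p - r - 2 + r) (altBinom r) w₃)
      = (-1 : ℂ) ^ h * t u w₂ (M₃.modeSeries v p (altBinom r) w₃) := by
    have s := congrArg (t u w₂) (M₃.sum_oppositeSeries_divPow hv hK' p (altBinom r) w₃)
    rw [map_sum, map_smul, smul_eq_mul] at s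
    rw [← s]
    refine Finset.sum_congr rfl fun j _ => ?_
    congr 2
    ring
  have e₂ : ∑ j ∈ Finset.range K, t u (M₂.modeSeries (divPow A.LOne j v)
      (2 * h - j - p - r - 2) (altBinom r) w₂) w₃
      = (-1 : ℂ) ^ h * t u (M₂.oppositeSeries v (p + r) (altBinom r) w₂) w₃ := by
    have s := congrArg ((t u).flip w₃)
      (M₂.sum_modeSeries_divPow hv hK' (p + r) (altBinom r) w₂)
    rw [map_sum, map_smul, smul_eq_mul] at s
    simp only [LinearMap.flip_apply] at s
    rw [← s]
    refine Finset.sum_congr rfl fun j _ => ?_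
    rw [show 2 * h - (j : ℤ) - p - r - 2 = 2 * h - j - (p + r) - 2 by ring]
  have e₁ : t (M₁.expLOne (M₁.signOp (M₁.modeSeries v r (binom p) w₁))) w₂ w₃
      = (-1 : ℂ) ^ (h - r - 1) * ∑ j ∈ Finset.range K, t (M₁.modeSeries (divPow A.LOne j v) r
        (binom (2 * h - j - p - r - 2)) u) w₂ w₃ := by
    rw [M₁.signOp_modeSeries_binom hv, map_smul, M₁.expLOne_modeSeries hv hK']
    simp only [map_smul, map_sum, LinearMap.smul_apply, LinearMap.sum_apply, smul_eq_mul, u]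
  rw [e₁, ← e, e₂, e₃]
  have hn : (-1 : ℂ) ≠ 0 := by norm_num
  have hs : ∀ k : ℤ, (-1 : ℂ) ^ (-k) = (-1) ^ k := fun k => by
    rw [zpow_neg, ← inv_zpow]; norm_num
  have hm : ∀ k : ℤ, (-1 : ℂ) ^ k * (-1) ^ k = 1 := fun k => by
    rw [← mul_zpow]; norm_num
  simp only [sub_eq_add_neg, zpow_add₀ hn, hs, zpow_one]
  have hp := hm h
  have hr := hm r
  grind

end ConformalBlocks

end VModule

/-! ### The conformal vector and projections to weight spaces -/

theorem VertexOperatorAlgebra.LOne_omega {V : Type*} [AddCommGroup V] [Module ℂ V]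
    (A : VertexOperatorAlgebra V) : A.LOne A.ω = 0 := by
  -- On the vacuum [L(1), L(-2)] = 3L(-1), where L(-2)𝟏 = ω and both L(1) and L(-1) kill 𝟏.
  have e := LinearMap.congr_fun (A.virasoro 1 (-2)) A.vac
  have h0 := (A.creation A.ω).1 0 le_rfl
  have h2 := (A.creation A.ω).1 2 (by norm_num)
  have h1 := (A.creation A.ω).2
  simp [h0, h1, h2] at e
  exact e

namespace VModule

section

variable {V : Type*} [AddCommGroup V] [Module ℂ V] {A : VertexOperatorAlgebra V}
    {W : Type*} [AddCommGroup W] [Module ℂ W] (M : VModule A W)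

/-- Since L(1)ω = 0 only k = 0 contributes, with mode index 2·2 - 0 - 1 - 2 = 1. So `L(0)` on W' is
the transpose of `L(0)` on W. -/
theorem oppositeMode_one_omega : M.oppositeMode 1 A.ω = M.mode 1 A.ω := by
  rw [M.oppositeMode_eq_sum A.omega_mem (K := 1)]
  · simp
  · intro k hk
    obtain ⟨l, rfl⟩ := Nat.exists_eq_add_of_le' hk
    simp [divPow, pow_succ, A.LOne_omega]

theorem mode_one_omega {a : ℂ} {w : W} (hw : w ∈ M.grade a) : M.mode 1 A.ω w = a • w :=
  M.L_zero a w hw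

theorem mode_zero_omega_mem {a : ℂ} {w : W} (hw : w ∈ M.grade a) :
    M.mode 0 A.ω w ∈ M.grade (a + 1) := by
  have e := M.mode_mem A.omega_mem 0 hw
  rwa [show a + ((2 : ℤ) : ℂ) - ((0 : ℤ) : ℂ) - 1 = a + 1 by push_cast; ring] at e

theorem modeSeries_altBinom_zero (v : V) (n : ℤ) (w : W) :
    M.modeSeries v n (altBinom 0) w = M.mode n v w := by
  rw [modeSeries, finsum_eq_single _ 0 fun i hi => by rw [altBinom_zero_left hi, zero_smul] ]
  simp

theorem oppositeSeries_altBinom_zero (v : V) (n : ℤ) (w : W) :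
    M.oppositeSeries v n (altBinom 0) w = M.oppositeMode n v w := by
  rw [oppositeSeries, finsum_eq_single _ 0 fun i hi => by rw [altBinom_zero_left hi, zero_smul] ]
  simp

theorem _root_.VertexTheory.binom_one_of_two_le {i : ℕ} (hi : 2 ≤ i) : binom 1 i = 0 := by
  have := binom_natCast 1 i
  rw [Nat.choose_eq_zero_of_lt (by omega)] at this
  simpa using this

theorem _root_.VertexTheory.binom_one_one : binom 1 1 = 1 := by
  simpa using binom_natCast 1 1

theorem modeSeries_binom_one (v : V) (n : ℤ) (w : W) :
    M.modeSeries v n (binom 1) w = M.mode n v w + M.mode (n + 1) v w := by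
  rw [modeSeries, finsum_eq_sum_range (N := 2) fun i hi => by
    rw [binom_one_of_two_le hi, zero_smul] ]
  simp [Finset.sum_range_succ, binom_one_one]

theorem modeSeries_add (v : V) (n : ℤ) (c : ℕ → ℂ) (w w' : W) :
    M.modeSeries v n c (w + w') = M.modeSeries v n c w + M.modeSeries v n c w' := by
  simp only [modeSeries, map_add, smul_add]
  exact finsum_add_distrib (finite_support_of_bound _ (M.modeSeries_bound v n c w))
    (finite_support_of_bound _ (M.modeSeries_bound v n c w'))

theorem oppositeSeries_add {h : ℤ} {v : V} (hv : v ∈ A.grade h) (n : ℤ) (c : ℕ → ℂ) (w w' : W) :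
    M.oppositeSeries v n c (w + w') = M.oppositeSeries v n c w + M.oppositeSeries v n c w' := by
  simp only [oppositeSeries, map_add, smul_add]
  exact finsum_add_distrib (finite_support_of_bound _ (M.oppositeSeries_bound hv n c w))
    (finite_support_of_bound _ (M.oppositeSeries_bound hv n c w'))

/-- The projection to the weight space `W_(c)`. -/
noncomputable def proj (c : ℂ) : Module.End ℂ W :=
  M.assemble fun a => if a = c then LinearMap.id else 0

theorem proj_of_mem (c : ℂ) {a : ℂ} {w : W} (hw : w ∈ M.grade a) :
    M.proj c w = if a = c then w else 0 := by
  rw [proj, M.assemble_of_mem _ hw]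
  split_ifs <;> rfl

/-- The restriction of a functional to the weight space `W_(c)`, extended by zero. -/
noncomputable def cut (c : ℂ) : Module.Dual ℂ W →ₗ[ℂ] M.gradedDual :=
  LinearMap.codRestrict M.gradedDual (M.proj c).dualMap fun f => by
    refine (Set.finite_singleton c).subset ?_
    rintro a ⟨w, hw, hne⟩
    rw [LinearMap.dualMap_apply, M.proj_of_mem c hw] at hne
    by_contra hac
    rw [if_neg (show a ≠ c from hac), map_zero] at hne
    exact hne rfl

theorem cut_apply_of_mem (c : ℂ) (f : Module.Dual ℂ W) {a : ℂ} {w : W} (hw : w ∈ M.grade a) :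
    (M.cut c f : Module.Dual ℂ W) w = if a = c then f w else 0 := by
  change f (M.proj c w) = _
  rw [M.proj_of_mem c hw]
  split_ifs <;> simp

end

/-! ### Families of operators and trilinear forms -/

variable {V : Type*} [AddCommGroup V] [Module ℂ V] {A : VertexOperatorAlgebra V}
  {W₁ W₂ W₃ : Type*} [AddCommGroup W₁] [Module ℂ W₁] [AddCommGroup W₂] [Module ℂ W₂]
  [AddCommGroup W₃] [Module ℂ W₃]
  (M₁ : VModule A W₁) (M₂ : VModule A W₂) (M₃ : VModule A W₃)

theorem trilinear_ext {X : Type*} [AddCommGroup X] [Module ℂ X]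
    {s t : W₁ →ₗ[ℂ] W₂ →ₗ[ℂ] W₃ →ₗ[ℂ] X}
    (h : ∀ a, ∀ w₁ ∈ M₁.grade a, ∀ b, ∀ w₂ ∈ M₂.grade b, ∀ c, ∀ w₃ ∈ M₃.grade c,
      s w₁ w₂ w₃ = t w₁ w₂ w₃) : s = t :=
  M₁.hom_ext fun a w₁ h₁ => M₂.hom_ext fun b w₂ h₂ => M₃.hom_ext fun c w₃ h₃ =>
    h a w₁ h₁ b w₂ h₂ c w₃ h₃

theorem family_ext {𝒴 𝒵 : W₁ →ₗ[ℂ] ℂ → (W₂ →ₗ[ℂ] M₃.gradedDual)}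
    (h : ∀ n, ∀ a, ∀ w₁ ∈ M₁.grade a, ∀ b, ∀ w₂ ∈ M₂.grade b, ∀ c, ∀ w₃ ∈ M₃.grade c,
      (𝒴 w₁ n w₂ : Module.Dual ℂ W₃) w₃ = (𝒵 w₁ n w₂ : Module.Dual ℂ W₃) w₃) : 𝒴 = 𝒵 := by
  refine M₁.hom_ext (X := ℂ → (W₂ →ₗ[ℂ] M₃.gradedDual)) fun a w₁ h₁ => ?_
  funext n
  refine M₂.hom_ext fun b w₂ h₂ => ?_
  exact Subtype.ext (M₃.hom_ext fun c w₃ h₃ => h n a w₁ h₁ b w₂ h₂ c w₃ h₃)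

/-- The value at `x = 1` of a homogeneous family of operators. -/
noncomputable def evalOne :
    (W₁ →ₗ[ℂ] ℂ → (W₂ →ₗ[ℂ] M₃.gradedDual)) →ₗ[ℂ] W₁ →ₗ[ℂ] W₂ →ₗ[ℂ] W₃ →ₗ[ℂ] ℂ where
  toFun 𝒴 := M₁.assemble fun a => M₂.assemble ∘ₗ LinearMap.pi fun b =>
    -- The mode n = a + b - c - 1 is the coefficient of x^(c-a-b), the one power expected between
    -- these weights.
    LinearMap.mk₂ ℂ (fun w₁ w₂ => M₃.assemble fun c => (𝒴 w₁ (a + b - c - 1) w₂).1)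
      (fun _ _ _ => by rw [← map_add]; congr 1; funext c; simp)
      (fun _ _ _ => by rw [← map_smul]; congr 1; funext c; simp)
      (fun _ _ _ => by rw [← map_add]; congr 1; funext c; simp)
      (fun _ _ _ => by rw [← map_smul]; congr 1; funext c; simp)
  map_add' 𝒴 𝒵 := trilinear_ext M₁ M₂ M₃ fun a w₁ h₁ b w₂ h₂ c w₃ h₃ => by
    simp [M₁.assemble_of_mem _ h₁, M₂.assemble_of_mem _ h₂, M₃.assemble_of_mem _ h₃]
  map_smul' c 𝒴 := trilinear_ext M₁ M₂ M₃ fun a w₁ h₁ b w₂ h₂ c w₃ h₃ => by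
    simp [M₁.assemble_of_mem _ h₁, M₂.assemble_of_mem _ h₂, M₃.assemble_of_mem _ h₃]

theorem evalOne_of_mem (𝒴 : W₁ →ₗ[ℂ] ℂ → (W₂ →ₗ[ℂ] M₃.gradedDual)) {a b c : ℂ} {w₁ : W₁}
    {w₂ : W₂} {w₃ : W₃} (h₁ : w₁ ∈ M₁.grade a) (h₂ : w₂ ∈ M₂.grade b) (h₃ : w₃ ∈ M₃.grade c) :
    evalOne M₁ M₂ M₃ 𝒴 w₁ w₂ w₃ = (𝒴 w₁ (a + b - c - 1) w₂ : Module.Dual ℂ W₃) w₃ := by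
  simp [evalOne, M₁.assemble_of_mem _ h₁, M₂.assemble_of_mem _ h₂, M₃.assemble_of_mem _ h₃]

/-- The homogeneous family of operators with a given value at `x = 1`. -/
noncomputable def homogeneousFamily :
    (W₁ →ₗ[ℂ] W₂ →ₗ[ℂ] W₃ →ₗ[ℂ] ℂ) →ₗ[ℂ] W₁ →ₗ[ℂ] ℂ → (W₂ →ₗ[ℂ] M₃.gradedDual) where
  toFun t := LinearMap.pi fun n => M₁.assemble fun a => M₂.assemble ∘ₗ LinearMap.pi fun b =>
    t.compr₂ (M₃.cut (a + b - n - 1))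
  map_add' s t := family_ext M₁ M₂ M₃ fun n a w₁ h₁ b w₂ h₂ c w₃ h₃ => by
    simp [M₁.assemble_of_mem _ h₁, M₂.assemble_of_mem _ h₂]
  map_smul' r t := family_ext M₁ M₂ M₃ fun n a w₁ h₁ b w₂ h₂ c w₃ h₃ => by
    simp [M₁.assemble_of_mem _ h₁, M₂.assemble_of_mem _ h₂]

/-- The family `𝒴` is homogeneous with value `t` at `x = 1`. -/
def IsExpansion (𝒴 : W₁ →ₗ[ℂ] ℂ → (W₂ →ₗ[ℂ] M₃.gradedDual))
    (t : W₁ →ₗ[ℂ] W₂ →ₗ[ℂ] W₃ →ₗ[ℂ] ℂ) : Prop :=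
  ∀ (a b c : ℂ), ∀ w₁ ∈ M₁.grade a, ∀ w₂ ∈ M₂.grade b, ∀ w₃ ∈ M₃.grade c, ∀ n : ℂ,
    (𝒴 w₁ n w₂ : Module.Dual ℂ W₃) w₃ = if n = a + b - c - 1 then t w₁ w₂ w₃ else 0

theorem isExpansion_homogeneousFamily (t : W₁ →ₗ[ℂ] W₂ →ₗ[ℂ] W₃ →ₗ[ℂ] ℂ) :
    IsExpansion M₁ M₂ M₃ (homogeneousFamily M₁ M₂ M₃ t) t := by
  intro a b c w₁ h₁ w₂ h₂ w₃ h₃ n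
  have e : homogeneousFamily M₁ M₂ M₃ t w₁ n w₂ = M₃.cut (a + b - n - 1) (t w₁ w₂) := by
    simp [homogeneousFamily, M₁.assemble_of_mem _ h₁, M₂.assemble_of_mem _ h₂]
  rw [e, M₃.cut_apply_of_mem _ _ h₃]
  refine if_congr ⟨fun h => ?_, fun h => ?_⟩ rfl rfl
  · rw [h]; ring
  · rw [h]; ring

/-! ### The Jacobi identity paired with W₃ -/

section Jacobi

variable {M₁ M₂ M₃}

/-- The sum with `Y₃(v, x₁)𝒴(w₁, x₂)` in the Jacobi identity, paired with a vector of `W₃`. -/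
noncomputable def leftSum (M₃ : VModule A W₃) (𝒴 : W₁ →ₗ[ℂ] ℂ → (W₂ →ₗ[ℂ] M₃.gradedDual))
    (r p : ℤ) (q : ℂ) (v : V) (w₁ : W₁) (w₂ : W₂) (w₃ : W₃) : ℂ :=
  ∑ᶠ i : ℕ, altBinom r i * (𝒴 w₁ (q + i) w₂ : Module.Dual ℂ W₃) (M₃.oppositeMode (p + r - i) v w₃)

/-- The sum with `𝒴(w₁, x₂)Y₂(v, x₁)` in the Jacobi identity, paired with a vector of `W₃`,
without the factor `(-1)ʳ`. -/
noncomputable def middleSum (M₂ : VModule A W₂) (M₃ : VModule A W₃)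
    (𝒴 : W₁ →ₗ[ℂ] ℂ → (W₂ →ₗ[ℂ] M₃.gradedDual))
    (r p : ℤ) (q : ℂ) (v : V) (w₁ : W₁) (w₂ : W₂) (w₃ : W₃) : ℂ :=
  ∑ᶠ i : ℕ, altBinom r i * (𝒴 w₁ (q + r - i) (M₂.mode (p + i) v w₂) : Module.Dual ℂ W₃) w₃

/-- The sum with `𝒴(Y₁(v, x₀)w₁, x₂)` in the Jacobi identity, paired with a vector of `W₃`. -/
noncomputable def rightSum (M₁ : VModule A W₁) (M₃ : VModule A W₃)
    (𝒴 : W₁ →ₗ[ℂ] ℂ → (W₂ →ₗ[ℂ] M₃.gradedDual))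
    (r p : ℤ) (q : ℂ) (v : V) (w₁ : W₁) (w₂ : W₂) (w₃ : W₃) : ℂ :=
  ∑ᶠ i : ℕ, binom p i * (𝒴 (M₁.mode (r + i) v w₁) (p + q - i) w₂ : Module.Dual ℂ W₃) w₃

/-- Lower truncation of a family of operators. -/
def IsTruncated (𝒴 : W₁ →ₗ[ℂ] ℂ → (W₂ →ₗ[ℂ] M₃.gradedDual)) : Prop :=
  ∀ w₁ w₂, ∃ N : ℝ, ∀ n : ℂ, N ≤ n.re → 𝒴 w₁ n w₂ = 0

variable {𝒴 : W₁ →ₗ[ℂ] ℂ → (W₂ →ₗ[ℂ] M₃.gradedDual)} {t : W₁ →ₗ[ℂ] W₂ →ₗ[ℂ] W₃ →ₗ[ℂ] ℂ}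

theorem IsTruncated.eventually (hY : IsTruncated 𝒴) (q : ℂ) (w₁ : W₁) (w₂ : W₂) :
    ∃ N, ∀ i : ℕ, N ≤ i → 𝒴 w₁ (q + i) w₂ = 0 := by
  obtain ⟨N, hN⟩ := hY w₁ w₂
  refine ⟨⌈N - q.re⌉₊, fun i hi => hN _ ?_⟩
  have h1 : N - q.re ≤ i := (Nat.le_ceil _).trans (by exact_mod_cast hi)
  simp
  linarith

theorem leftSum_support (hY : IsTruncated 𝒴) (r p : ℤ) (q : ℂ) (v : V) (w₁ : W₁) (w₂ : W₂)
    (w₃ : W₃) : (Function.support fun i : ℕ => altBinom r i *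
      (𝒴 w₁ (q + i) w₂ : Module.Dual ℂ W₃) (M₃.oppositeMode (p + r - i) v w₃)).Finite := by
  obtain ⟨N, hN⟩ := hY.eventually q w₁ w₂
  exact finite_support_of_bound _ ⟨N, fun i hi => by simp [hN i hi]⟩

theorem middleSum_support (M₂ : VModule A W₂) (𝒴 : W₁ →ₗ[ℂ] ℂ → (W₂ →ₗ[ℂ] M₃.gradedDual))
    (r p : ℤ) (q : ℂ) (v : V) (w₁ : W₁) (w₂ : W₂)
    (w₃ : W₃) : (Function.support fun i : ℕ => altBinom r i *
      (𝒴 w₁ (q + r - i) (M₂.mode (p + i) v w₂) : Module.Dual ℂ W₃) w₃).Finite := by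
  obtain ⟨N, hN⟩ := M₂.mode_eventually v p w₂
  exact finite_support_of_bound _ ⟨N, fun i hi => by simp [hN i hi]⟩

theorem rightSum_support (M₁ : VModule A W₁) (𝒴 : W₁ →ₗ[ℂ] ℂ → (W₂ →ₗ[ℂ] M₃.gradedDual))
    (r p : ℤ) (q : ℂ) (v : V) (w₁ : W₁) (w₂ : W₂)
    (w₃ : W₃) : (Function.support fun i : ℕ => binom p i *
      (𝒴 (M₁.mode (r + i) v w₁) (p + q - i) w₂ : Module.Dual ℂ W₃) w₃).Finite := by
  obtain ⟨N, hN⟩ := M₁.mode_eventually v r w₁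
  exact finite_support_of_bound _ ⟨N, fun i hi => by simp [hN i hi]⟩

/-- The Jacobi identity in an intertwining operator, paired with vectors of `W₃`. -/
theorem jacobi_iff (hY : IsTruncated 𝒴) (r p : ℤ) (q : ℂ) (v : V) (w₁ : W₁) (w₂ : W₂) :
    ((∑ᶠ i : ℕ, ((-1 : ℂ) ^ i * (Ring.choose r i : ℤ)) •
        ((M₃.contragredient.Y v)[[p + r - i]]) (𝒴 w₁ (q + i) w₂))
      - (∑ᶠ i : ℕ, ((-1 : ℂ) ^ r * (-1 : ℂ) ^ i * (Ring.choose r i : ℤ)) •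
        𝒴 w₁ (q + r - i) (((M₂.Y v)[[p + i]]) w₂))
      = ∑ᶠ i : ℕ, ((Ring.choose p i : ℤ) : ℂ) • 𝒴 (((M₁.Y v)[[r + i]]) w₁) (p + q - i) w₂) ↔
    ∀ w₃, leftSum M₃ 𝒴 r p q v w₁ w₂ w₃ - (-1) ^ r * middleSum M₂ M₃ 𝒴 r p q v w₁ w₂ w₃
      = rightSum M₁ M₃ 𝒴 r p q v w₁ w₂ w₃ := by
  rw [Subtype.ext_iff, LinearMap.ext_iff]
  refine forall_congr' fun w₃ => ?_
  set ev : M₃.gradedDual →ₗ[ℂ] ℂ := LinearMap.applyₗ w₃ ∘ₗ M₃.gradedDual.subtype with hev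
  have hev' : ∀ f : M₃.gradedDual, (f : Module.Dual ℂ W₃) w₃ = ev f := fun _ => rfl
  simp only [hev', map_sub]
  obtain ⟨N₁, hN₁⟩ := hY.eventually q w₁ w₂
  obtain ⟨N₂, hN₂⟩ := M₂.mode_eventually v p w₂
  obtain ⟨N₃, hN₃⟩ := M₁.mode_eventually v r w₁
  have hN₂' : ∀ i : ℕ, N₂ ≤ i → ((M₂.Y v)[[p + i]]) w₂ = 0 := hN₂
  have hN₃' : ∀ i : ℕ, N₃ ≤ i → ((M₁.Y v)[[r + i]]) w₁ = 0 := hN₃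
  rw [map_finsum_of_bound ev ⟨N₁, fun i hi => by rw [hN₁ i hi, map_zero, smul_zero]⟩,
    map_finsum_of_bound ev ⟨N₂, fun i hi => by rw [hN₂' i hi, map_zero, smul_zero]⟩,
    map_finsum_of_bound ev ⟨N₃, fun i hi => by simp [hN₃' i hi]⟩]
  have e₁ : ∑ᶠ i : ℕ, ev (((-1 : ℂ) ^ i * (Ring.choose r i : ℤ)) •
        ((M₃.contragredient.Y v)[[p + r - i]]) (𝒴 w₁ (q + i) w₂))
      = leftSum M₃ 𝒴 r p q v w₁ w₂ w₃ := by
    refine finsum_congr fun i => ?_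
    rw [map_smul, smul_eq_mul]
    exact congrArg _ (M₃.contragredientY_ncoeff v _ _ w₃)
  have e₂ : ∑ᶠ i : ℕ, ev (((-1 : ℂ) ^ r * (-1 : ℂ) ^ i * (Ring.choose r i : ℤ)) •
        𝒴 w₁ (q + r - i) (((M₂.Y v)[[p + i]]) w₂))
      = (-1) ^ r * middleSum M₂ M₃ 𝒴 r p q v w₁ w₂ w₃ := by
    rw [middleSum, ← smul_eq_mul, smul_finsum]
    refine finsum_congr fun i => ?_
    rw [map_smul, smul_eq_mul, smul_eq_mul, mul_assoc, mul_assoc]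
    simp only [altBinom, mul_assoc]
    rfl
  have e₃ : ∑ᶠ i : ℕ, ev (((Ring.choose p i : ℤ) : ℂ) •
        𝒴 (((M₁.Y v)[[r + i]]) w₁) (p + q - i) w₂) = rightSum M₁ M₃ 𝒴 r p q v w₁ w₂ w₃ := by
    refine finsum_congr fun i => ?_
    rw [map_smul, smul_eq_mul]
    rfl
  rw [e₁, e₂, e₃]

end Jacobi

end VModule

/-! ### Intertwining operators correspond to conformal blocks -/

namespace VModule

variable {V : Type*} [AddCommGroup V] [Module ℂ V] {A : VertexOperatorAlgebra V}
  {W₁ W₂ W₃ : Type*} [AddCommGroup W₁] [Module ℂ W₁] [AddCommGroup W₂] [Module ℂ W₂]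
  [AddCommGroup W₃] [Module ℂ W₃]
  {M₁ : VModule A W₁} {M₂ : VModule A W₂} {M₃ : VModule A W₃}
  {𝒴 : W₁ →ₗ[ℂ] ℂ → (W₂ →ₗ[ℂ] M₃.gradedDual)} {t : W₁ →ₗ[ℂ] W₂ →ₗ[ℂ] W₃ →ₗ[ℂ] ℂ}

section Homogeneous

variable (hYt : IsExpansion M₁ M₂ M₃ 𝒴 t) {h : ℤ} {v : V} (hv : v ∈ A.grade h) {a b c : ℂ}
  {w₁ : W₁} {w₂ : W₂} {w₃ : W₃} (h₁ : w₁ ∈ M₁.grade a) (h₂ : w₂ ∈ M₂.grade b)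
  (h₃ : w₃ ∈ M₃.grade c) (r p : ℤ) (q : ℂ)

include hYt hv h₁ h₂ h₃

/-- Increasing i shifts the mode of `𝒴` and the weight of the vector it meets in step, so the
condition for a nonzero term does not involve i. The same q arises in all three sums, so the Jacobi
identity lives at that q alone. -/
theorem leftSum_of_isExpansion : leftSum M₃ 𝒴 r p q v w₁ w₂ w₃
    = if q = a + b - c + h - p - r - 2 then
        t w₁ w₂ (M₃.oppositeSeries v (p + r) (altBinom r) w₃) else 0 := by
  have e : ∀ i : ℕ, altBinom r i *
      (𝒴 w₁ (q + i) w₂ : Module.Dual ℂ W₃) (M₃.oppositeMode (p + r - i) v w₃)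
      = if q = a + b - c + h - p - r - 2 then
        altBinom r i • t w₁ w₂ (M₃.oppositeMode (p + r - i) v w₃) else 0 := by
    intro i
    rw [hYt a b _ w₁ h₁ w₂ h₂ _ (M₃.oppositeMode_mem hv (p + r - i) h₃), mul_ite, mul_zero,
      smul_eq_mul]
    refine if_congr ⟨fun hq => ?_, fun hq => ?_⟩ rfl rfl
    · push_cast at hq
      linear_combination hq
    · push_cast
      linear_combination hq
  rw [leftSum, finsum_congr e]
  split_ifs
  · rw [M₃.map_oppositeSeries _ hv]
  · simp

theorem middleSum_of_isExpansion : middleSum M₂ M₃ 𝒴 r p q v w₁ w₂ w₃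
    = if q = a + b - c + h - p - r - 2 then
        t w₁ (M₂.modeSeries v p (altBinom r) w₂) w₃ else 0 := by
  have e : ∀ i : ℕ, altBinom r i *
      (𝒴 w₁ (q + r - i) (M₂.mode (p + i) v w₂) : Module.Dual ℂ W₃) w₃
      = if q = a + b - c + h - p - r - 2 then
        altBinom r i • (t w₁).flip w₃ (M₂.mode (p + i) v w₂) else 0 := by
    intro i
    rw [hYt a _ c w₁ h₁ _ (M₂.mode_apply_mem hv (p + i) h₂) _ h₃, mul_ite,
      mul_zero, smul_eq_mul]
    refine if_congr ⟨fun hq => ?_, fun hq => ?_⟩ rfl rfl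
    · push_cast at hq
      linear_combination hq
    · push_cast
      linear_combination hq
  rw [middleSum, finsum_congr e]
  split_ifs
  · rw [← M₂.map_modeSeries, LinearMap.flip_apply]
  · simp

theorem rightSum_of_isExpansion : rightSum M₁ M₃ 𝒴 r p q v w₁ w₂ w₃
    = if q = a + b - c + h - p - r - 2 then
        t (M₁.modeSeries v r (binom p) w₁) w₂ w₃ else 0 := by
  have e : ∀ i : ℕ, binom p i *
      (𝒴 (M₁.mode (r + i) v w₁) (p + q - i) w₂ : Module.Dual ℂ W₃) w₃
      = if q = a + b - c + h - p - r - 2 then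
        binom p i • (t.flip w₂).flip w₃ (M₁.mode (r + i) v w₁) else 0 := by
    intro i
    rw [hYt _ b c _ (M₁.mode_apply_mem hv (r + i) h₁) _ h₂ _ h₃, mul_ite,
      mul_zero, smul_eq_mul]
    refine if_congr ⟨fun hq => ?_, fun hq => ?_⟩ rfl rfl
    · push_cast at hq
      linear_combination hq
    · push_cast
      linear_combination hq
  rw [rightSum, finsum_congr e]
  split_ifs
  · rw [← M₁.map_modeSeries, LinearMap.flip_apply, LinearMap.flip_apply]
  · simp

end Homogeneous

section Additivity

theorem leftSum_add (hY : IsTruncated 𝒴) (r p : ℤ) (q : ℂ) (v v' : V) (w₁ w₁' : W₁)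
    (w₂ w₂' : W₂) (w₃ w₃' : W₃) :
    leftSum M₃ 𝒴 r p q (v + v') w₁ w₂ w₃
      = leftSum M₃ 𝒴 r p q v w₁ w₂ w₃ + leftSum M₃ 𝒴 r p q v' w₁ w₂ w₃ ∧
    leftSum M₃ 𝒴 r p q v (w₁ + w₁') w₂ w₃
      = leftSum M₃ 𝒴 r p q v w₁ w₂ w₃ + leftSum M₃ 𝒴 r p q v w₁' w₂ w₃ ∧
    leftSum M₃ 𝒴 r p q v w₁ (w₂ + w₂') w₃
      = leftSum M₃ 𝒴 r p q v w₁ w₂ w₃ + leftSum M₃ 𝒴 r p q v w₁ w₂' w₃ ∧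
    leftSum M₃ 𝒴 r p q v w₁ w₂ (w₃ + w₃')
      = leftSum M₃ 𝒴 r p q v w₁ w₂ w₃ + leftSum M₃ 𝒴 r p q v w₁ w₂ w₃' := by
  simp only [leftSum, map_add, LinearMap.add_apply, Pi.add_apply, Submodule.coe_add, mul_add]
  refine ⟨?_, ?_, ?_, ?_⟩ <;>
    exact finsum_add_distrib (leftSum_support hY ..) (leftSum_support hY ..)

theorem middleSum_add (r p : ℤ) (q : ℂ) (v v' : V) (w₁ w₁' : W₁)
    (w₂ w₂' : W₂) (w₃ w₃' : W₃) :
    middleSum M₂ M₃ 𝒴 r p q (v + v') w₁ w₂ w₃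
      = middleSum M₂ M₃ 𝒴 r p q v w₁ w₂ w₃ + middleSum M₂ M₃ 𝒴 r p q v' w₁ w₂ w₃ ∧
    middleSum M₂ M₃ 𝒴 r p q v (w₁ + w₁') w₂ w₃
      = middleSum M₂ M₃ 𝒴 r p q v w₁ w₂ w₃ + middleSum M₂ M₃ 𝒴 r p q v w₁' w₂ w₃ ∧
    middleSum M₂ M₃ 𝒴 r p q v w₁ (w₂ + w₂') w₃
      = middleSum M₂ M₃ 𝒴 r p q v w₁ w₂ w₃ + middleSum M₂ M₃ 𝒴 r p q v w₁ w₂' w₃ ∧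
    middleSum M₂ M₃ 𝒴 r p q v w₁ w₂ (w₃ + w₃')
      = middleSum M₂ M₃ 𝒴 r p q v w₁ w₂ w₃ + middleSum M₂ M₃ 𝒴 r p q v w₁ w₂ w₃' := by
  simp only [middleSum, map_add, LinearMap.add_apply, Pi.add_apply, Submodule.coe_add, mul_add]
  refine ⟨?_, ?_, ?_, ?_⟩ <;>
    exact finsum_add_distrib (middleSum_support M₂ 𝒴 ..) (middleSum_support M₂ 𝒴 ..)

theorem rightSum_add (r p : ℤ) (q : ℂ) (v v' : V) (w₁ w₁' : W₁)
    (w₂ w₂' : W₂) (w₃ w₃' : W₃) :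
    rightSum M₁ M₃ 𝒴 r p q (v + v') w₁ w₂ w₃
      = rightSum M₁ M₃ 𝒴 r p q v w₁ w₂ w₃ + rightSum M₁ M₃ 𝒴 r p q v' w₁ w₂ w₃ ∧
    rightSum M₁ M₃ 𝒴 r p q v (w₁ + w₁') w₂ w₃
      = rightSum M₁ M₃ 𝒴 r p q v w₁ w₂ w₃ + rightSum M₁ M₃ 𝒴 r p q v w₁' w₂ w₃ ∧
    rightSum M₁ M₃ 𝒴 r p q v w₁ (w₂ + w₂') w₃
      = rightSum M₁ M₃ 𝒴 r p q v w₁ w₂ w₃ + rightSum M₁ M₃ 𝒴 r p q v w₁ w₂' w₃ ∧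
    rightSum M₁ M₃ 𝒴 r p q v w₁ w₂ (w₃ + w₃')
      = rightSum M₁ M₃ 𝒴 r p q v w₁ w₂ w₃ + rightSum M₁ M₃ 𝒴 r p q v w₁ w₂ w₃' := by
  simp only [rightSum, map_add, LinearMap.add_apply, Pi.add_apply, Submodule.coe_add, mul_add]
  refine ⟨?_, ?_, ?_, ?_⟩ <;>
    exact finsum_add_distrib (rightSum_support M₁ 𝒴 ..) (rightSum_support M₁ 𝒴 ..)

/-- It suffices to check the Jacobi identity on homogeneous vectors. -/
theorem jacobi_of_homogeneous (hY : IsTruncated 𝒴) (r p : ℤ) (q : ℂ)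
    (H : ∀ h, ∀ v ∈ A.grade h, ∀ a, ∀ w₁ ∈ M₁.grade a, ∀ b, ∀ w₂ ∈ M₂.grade b,
      ∀ c, ∀ w₃ ∈ M₃.grade c,
      leftSum M₃ 𝒴 r p q v w₁ w₂ w₃ - (-1) ^ r * middleSum M₂ M₃ 𝒴 r p q v w₁ w₂ w₃
        = rightSum M₁ M₃ 𝒴 r p q v w₁ w₂ w₃) (v : V) (w₁ : W₁) (w₂ : W₂) (w₃ : W₃) :
    leftSum M₃ 𝒴 r p q v w₁ w₂ w₃ - (-1) ^ r * middleSum M₂ M₃ 𝒴 r p q v w₁ w₂ w₃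
      = rightSum M₁ M₃ 𝒴 r p q v w₁ w₂ w₃ := by
  induction v using grade_induction A with
  | h0 => simp [leftSum, middleSum, rightSum]
  | hadd u v hu hv =>
    rw [(leftSum_add hY r p q u v w₁ 0 w₂ 0 w₃ 0).1, (middleSum_add r p q u v w₁ 0 w₂ 0 w₃ 0).1,
      (rightSum_add r p q u v w₁ 0 w₂ 0 w₃ 0).1]
    linear_combination hu + hv
  | hom h v =>
  induction w₁ using M₁.hom_induction with
  | h0 => simp [leftSum, middleSum, rightSum]
  | hadd u u' hu hu' =>
    rw [(leftSum_add hY r p q v 0 u u' w₂ 0 w₃ 0).2.1, (middleSum_add r p q _ 0 u u' w₂ 0 w₃ 0).2.1,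
      (rightSum_add r p q _ 0 u u' w₂ 0 w₃ 0).2.1]
    linear_combination hu + hu'
  | hom a w₁ h₁ =>
  induction w₂ using M₂.hom_induction with
  | h0 => simp [leftSum, middleSum, rightSum]
  | hadd u u' hu hu' =>
    rw [(leftSum_add hY r p q v 0 w₁ 0 u u' w₃ 0).2.2.1,
      (middleSum_add r p q _ 0 w₁ 0 u u' w₃ 0).2.2.1, (rightSum_add r p q _ 0 w₁ 0 u u' w₃ 0).2.2.1]
    linear_combination hu + hu'
  | hom b w₂ h₂ =>
  induction w₃ using M₃.hom_induction with
  | h0 => simp [leftSum, middleSum, rightSum]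
  | hadd u u' hu hu' =>
    rw [(leftSum_add hY r p q v 0 w₁ 0 w₂ 0 u u').2.2.2,
      (middleSum_add r p q _ 0 w₁ 0 w₂ 0 u u').2.2.2, (rightSum_add r p q _ 0 w₁ 0 w₂ 0 u u').2.2.2]
    linear_combination hu + hu'
  | hom c w₃ h₃ => exact H h v v.2 a w₁ h₁ b w₂ h₂ c w₃ h₃

end Additivity

/-- It suffices to check the residue identity of conformal blocks on homogeneous vectors. -/
theorem mem_conformalBlocks_of_homogeneous
    (H : ∀ h, ∀ v ∈ A.grade h, ∀ (r p : ℤ) (a : ℂ), ∀ w₁ ∈ M₁.grade a, ∀ b, ∀ w₂ ∈ M₂.grade b,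
      ∀ c, ∀ w₃ ∈ M₃.grade c,
      t w₁ w₂ (M₃.oppositeSeries v (p + r) (altBinom r) w₃)
        - (-1 : ℂ) ^ r * t w₁ (M₂.modeSeries v p (altBinom r) w₂) w₃
        = t (M₁.modeSeries v r (binom p) w₁) w₂ w₃) : t ∈ conformalBlocks M₁ M₂ M₃ := by
  intro h v hv r p w₁ w₂ w₃
  induction w₁ using M₁.hom_induction with
  | h0 => simp [modeSeries]
  | hadd u u' hu hu' =>
    rw [M₁.modeSeries_add]
    simp only [map_add, LinearMap.add_apply]
    linear_combination hu + hu'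
  | hom a w₁ h₁ =>
  induction w₂ using M₂.hom_induction with
  | h0 => simp [modeSeries]
  | hadd u u' hu hu' =>
    rw [M₂.modeSeries_add]
    simp only [map_add, LinearMap.add_apply]
    linear_combination hu + hu'
  | hom b w₂ h₂ =>
  induction w₃ using M₃.hom_induction with
  | h0 => simp [oppositeSeries]
  | hadd u u' hu hu' =>
    rw [M₃.oppositeSeries_add hv]
    simp only [map_add]
    linear_combination hu + hu'
  | hom c w₃ h₃ => exact H h v hv r p a w₁ h₁ b w₂ h₂ c w₃ h₃

/-- Intertwining operators are homogeneous. -/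
theorem isExpansion_evalOne
    (hY : IsIntertwining A M₁.toVModuleData M₂.toVModuleData M₃.contragredient 𝒴) :
    IsExpansion M₁ M₂ M₃ 𝒴 (evalOne M₁ M₂ M₃ 𝒴) := by
  intro a b c w₁ h₁ w₂ h₂ w₃ h₃ n
  split_ifs with hn
  · rw [evalOne_of_mem M₁ M₂ M₃ 𝒴 h₁ h₂ h₃, hn]
  -- With v = ω, r = 0, p = 1 this is [L(0), (w₁)ₙ] = (L(-1)w₁)_{n+1} + (L(0)w₁)ₙ. The derivative
  -- property turns the first term on the right into -(n + 1)(w₁)ₙ.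
  · have e := (jacobi_iff hY.truncation 0 1 n A.ω w₁ w₂).mp (hY.jacobi A.ω w₁ w₂ 0 1 n) w₃
    rw [leftSum, middleSum, rightSum,
      finsum_eq_single _ 0 fun i hi => by rw [altBinom_zero_left hi, zero_mul],
      finsum_eq_single _ 0 fun i hi => by rw [altBinom_zero_left hi, zero_mul],
      finsum_eq_sum_range (N := 2) fun i hi => by rw [binom_one_of_two_le hi, zero_mul] ] at e
    have hd := hY.derivative w₁ (1 + n)
    have hd' : 𝒴 (M₁.mode 0 A.ω w₁) (1 + n) = (-(1 + n)) • 𝒴 w₁ n := by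
      rw [show n = 1 + n - 1 by ring, show 1 + (1 + n - 1) = 1 + n by ring]
      exact hd
    simp [Finset.sum_range_succ, binom_one_one, hd', M₃.oppositeMode_one_omega,
      M₃.mode_one_omega h₃, M₂.mode_one_omega h₂, M₁.mode_one_omega h₁] at e
    have e' : (n - (a + b - c - 1)) * (𝒴 w₁ n w₂ : Module.Dual ℂ W₃) w₃ = 0 := by
      linear_combination e
    exact (mul_eq_zero.mp e').resolve_left (sub_ne_zero.mpr hn)

theorem evalOne_mem
    (hY : IsIntertwining A M₁.toVModuleData M₂.toVModuleData M₃.contragredient 𝒴) :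
    evalOne M₁ M₂ M₃ 𝒴 ∈ conformalBlocks M₁ M₂ M₃ := by
  refine mem_conformalBlocks_of_homogeneous fun h v hv r p a w₁ h₁ b w₂ h₂ c w₃ h₃ => ?_
  have hE := isExpansion_evalOne hY
  have e := (jacobi_iff hY.truncation r p (a + b - c + h - p - r - 2) v w₁ w₂).mp
    (hY.jacobi v w₁ w₂ r p _) w₃
  rwa [leftSum_of_isExpansion hE hv h₁ h₂ h₃, middleSum_of_isExpansion hE hv h₁ h₂ h₃,
    rightSum_of_isExpansion hE hv h₁ h₂ h₃, if_pos rfl, if_pos rfl, if_pos rfl] at e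

theorem eq_of_evalOne_eq {𝒵 : W₁ →ₗ[ℂ] ℂ → (W₂ →ₗ[ℂ] M₃.gradedDual)}
    (hY : IsIntertwining A M₁.toVModuleData M₂.toVModuleData M₃.contragredient 𝒴)
    (hZ : IsIntertwining A M₁.toVModuleData M₂.toVModuleData M₃.contragredient 𝒵)
    (h : evalOne M₁ M₂ M₃ 𝒴 = evalOne M₁ M₂ M₃ 𝒵) : 𝒴 = 𝒵 :=
  family_ext M₁ M₂ M₃ fun n a w₁ h₁ b w₂ h₂ c w₃ h₃ => by
    rw [isExpansion_evalOne hY a b c w₁ h₁ w₂ h₂ w₃ h₃,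
      isExpansion_evalOne hZ a b c w₁ h₁ w₂ h₂ w₃ h₃, h]

theorem IsExpansion.isTruncated (hYt : IsExpansion M₁ M₂ M₃ 𝒴 t) : IsTruncated 𝒴 := by
  intro w₁ w₂
  induction w₁ using M₁.hom_induction with
  | h0 => exact ⟨0, by simp⟩
  | hadd u u' hu hu' =>
    obtain ⟨N, hN⟩ := hu
    obtain ⟨K, hK⟩ := hu'
    exact ⟨max N K, fun n hn => by
      simp [hN n (le_trans (le_max_left _ _) hn), hK n (le_trans (le_max_right _ _) hn)]⟩
  | hom a w₁ h₁ =>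
  induction w₂ using M₂.hom_induction with
  | h0 => exact ⟨0, by simp⟩
  | hadd u u' hu hu' =>
    obtain ⟨N, hN⟩ := hu
    obtain ⟨K, hK⟩ := hu'
    exact ⟨max N K, fun n hn => by
      simp [hN n (le_trans (le_max_left _ _) hn), hK n (le_trans (le_max_right _ _) hn)]⟩
  | hom b w₂ h₂ =>
    obtain ⟨B, hB⟩ := M₃.lower_bounded
    -- A nonzero pairing needs Re n = Re a + Re b - Re c - 1; beyond this bound that forces Re c <
    -- B, where W₃ has no vectors.
    refine ⟨a.re + b.re - B, fun n hn => Subtype.ext (M₃.hom_ext fun c w₃ h₃ => ?_)⟩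
    rw [hYt a b c w₁ h₁ w₂ h₂ w₃ h₃]
    split_ifs with hc
    · have hre := congrArg Complex.re hc
      simp at hre
      rw [hB c (by linarith)] at h₃
      rw [(Submodule.mem_bot ℂ).mp h₃]
      simp
    · simp

/-- The residue identity for ω and the function x: it gives `L(0)` at ∞ and at 0, and, as x = 1 + (x
- 1), it gives `L(-1) + L(0)` at 1. -/
theorem conformalBlocks_translation (ht : t ∈ conformalBlocks M₁ M₂ M₃) {a b c : ℂ}
    {w₁ : W₁} {w₂ : W₂} {w₃ : W₃} (h₁ : w₁ ∈ M₁.grade a) (h₂ : w₂ ∈ M₂.grade b)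
    (h₃ : w₃ ∈ M₃.grade c) : t (M₁.mode 0 A.ω w₁) w₂ w₃ = (c - a - b) * t w₁ w₂ w₃ := by
  have e := ht 2 A.ω A.omega_mem 0 1 w₁ w₂ w₃
  rw [oppositeSeries_altBinom_zero, modeSeries_altBinom_zero, modeSeries_binom_one, add_zero,
    zero_add, oppositeMode_one_omega, M₁.mode_one_omega h₁, M₂.mode_one_omega h₂,
    M₃.mode_one_omega h₃] at e
  simp at e
  linear_combination -e

/-- Off the critical q all three sums vanish; at it, the Jacobi identity is the residue identity of
t. The derivative property matters only at n = a + b - c, where the factor c - a - b of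
`conformalBlocks_translation` is -n. -/
theorem IsExpansion.isIntertwining (hYt : IsExpansion M₁ M₂ M₃ 𝒴 t)
    (ht : t ∈ conformalBlocks M₁ M₂ M₃) :
    IsIntertwining A M₁.toVModuleData M₂.toVModuleData M₃.contragredient 𝒴 where
  truncation := hYt.isTruncated
  jacobi v w₁ w₂ r p q := by
    refine (jacobi_iff hYt.isTruncated r p q v w₁ w₂).mpr
      (jacobi_of_homogeneous hYt.isTruncated r p q (fun h v hv a w₁ h₁ b w₂ h₂ c w₃ h₃ => ?_)
        v w₁ w₂)
    rw [leftSum_of_isExpansion hYt hv h₁ h₂ h₃, middleSum_of_isExpansion hYt hv h₁ h₂ h₃,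
      rightSum_of_isExpansion hYt hv h₁ h₂ h₃, ← ht h v hv]
    split_ifs <;> simp
  derivative w₁ n := by
    change 𝒴 (M₁.mode 0 A.ω w₁) n = (-n) • 𝒴 w₁ (n - 1)
    refine M₂.hom_ext fun b w₂ h₂ => Subtype.ext (M₃.hom_ext fun c w₃ h₃ => ?_)
    induction w₁ using M₁.hom_induction with
    | h0 => simp
    | hadd u u' hu hu' =>
      simp only [map_add, Pi.add_apply, LinearMap.add_apply, Submodule.coe_add, smul_add, hu, hu']
    | hom a w₁ h₁ =>
      rw [hYt _ b c _ (M₁.mode_zero_omega_mem h₁) w₂ h₂ w₃ h₃]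
      simp only [LinearMap.smul_apply, Submodule.coe_smul]
      rw [hYt a b c w₁ h₁ w₂ h₂ w₃ h₃, conformalBlocks_translation ht h₁ h₂ h₃]
      by_cases hn : n = a + b - c
      · rw [if_pos (by rw [hn]; ring), if_pos (by rw [hn]), hn, smul_eq_mul]
        ring
      · rw [if_neg (fun h => hn (by linear_combination h)),
          if_neg (fun h => hn (by linear_combination h)), smul_zero]

theorem homogeneousFamily_injective : Function.Injective (homogeneousFamily M₁ M₂ M₃) := by
  intro s t hst
  refine trilinear_ext M₁ M₂ M₃ fun a w₁ h₁ b w₂ h₂ c w₃ h₃ => ?_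
  have es := isExpansion_homogeneousFamily M₁ M₂ M₃ s a b c w₁ h₁ w₂ h₂ w₃ h₃ (a + b - c - 1)
  have et := isExpansion_homogeneousFamily M₁ M₂ M₃ t a b c w₁ h₁ w₂ h₂ w₃ h₃ (a + b - c - 1)
  rw [if_pos rfl] at es et
  rw [← es, ← et, hst]

/-- Evaluation at x = 1 and homogeneous extension are both injective, which suffices for cardinals.
Indexing the modules by `Fin 3` keeps them in one universe, so the ranks can be compared directly.
-/
theorem fusionNumber_eq_rank {W : Fin 3 → Type*} [∀ i, AddCommGroup (W i)]
    [∀ i, Module ℂ (W i)] (M : ∀ i, VModule A (W i)) (i j k : Fin 3) :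
    fusionNumber (M i) (M j) (M k) = Module.rank ℂ (conformalBlocks (M i) (M j) (M k)) := by
  refine le_antisymm ?_ ?_
  · refine LinearMap.rank_le_of_injective (((evalOne (M i) (M j) (M k)).domRestrict
      (intertwiningSpace A (M i).toVModuleData (M j).toVModuleData (M k).contragredient)).codRestrict
      _ fun 𝒴 => evalOne_mem 𝒴.2) ?_
    intro 𝒴 𝒵 h
    exact Subtype.ext (eq_of_evalOne_eq 𝒴.2 𝒵.2 (congrArg Subtype.val h))
  · refine LinearMap.rank_le_of_injective (((homogeneousFamily (M i) (M j) (M k)).domRestrict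
      (conformalBlocks (M i) (M j) (M k))).codRestrict
      (intertwiningSpace A (M i).toVModuleData (M j).toVModuleData (M k).contragredient)
      fun t => (isExpansion_homogeneousFamily (M i) (M j) (M k) t.1).isIntertwining t.2) ?_
    intro s t h
    exact Subtype.ext (homogeneousFamily_injective (congrArg Subtype.val h))

/-! ### Symmetry of the fusion numbers -/

theorem rank_conformalBlocks_swapFirst_le {W : Fin 3 → Type*} [∀ i, AddCommGroup (W i)]
    [∀ i, Module ℂ (W i)] (M : ∀ i, VModule A (W i)) (i j k : Fin 3) :
    Module.rank ℂ (conformalBlocks (M i) (M j) (M k))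
      ≤ Module.rank ℂ (conformalBlocks (M j) (M i) (M k)) :=
  LinearMap.rank_le_of_injective (((swapFirst (M i) (M j) (M k)).domRestrict
    (conformalBlocks (M i) (M j) (M k))).codRestrict _ fun t => swapFirst_mem _ _ _ t.2)
    fun _ _ h => Subtype.ext (swapFirst_injective _ _ _ (congrArg Subtype.val h))

theorem rank_conformalBlocks_swapLast_le {W : Fin 3 → Type*} [∀ i, AddCommGroup (W i)]
    [∀ i, Module ℂ (W i)] (M : ∀ i, VModule A (W i)) (i j k : Fin 3) :
    Module.rank ℂ (conformalBlocks (M i) (M j) (M k))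
      ≤ Module.rank ℂ (conformalBlocks (M i) (M k) (M j)) :=
  LinearMap.rank_le_of_injective (((swapLast (M i)).domRestrict
    (conformalBlocks (M i) (M j) (M k))).codRestrict _ fun t => swapLast_mem _ _ _ t.2)
    fun _ _ h => Subtype.ext (swapLast_injective _ (congrArg Subtype.val h))

theorem fusionNumber_swapFirst {W : Fin 3 → Type*} [∀ i, AddCommGroup (W i)]
    [∀ i, Module ℂ (W i)] (M : ∀ i, VModule A (W i)) (i j k : Fin 3) :
    fusionNumber (M i) (M j) (M k) = fusionNumber (M j) (M i) (M k) := by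
  rw [fusionNumber_eq_rank, fusionNumber_eq_rank]
  exact le_antisymm (rank_conformalBlocks_swapFirst_le M i j k)
    (rank_conformalBlocks_swapFirst_le M j i k)

theorem fusionNumber_swapLast {W : Fin 3 → Type*} [∀ i, AddCommGroup (W i)]
    [∀ i, Module ℂ (W i)] (M : ∀ i, VModule A (W i)) (i j k : Fin 3) :
    fusionNumber (M i) (M j) (M k) = fusionNumber (M i) (M k) (M j) := by
  rw [fusionNumber_eq_rank, fusionNumber_eq_rank]
  exact le_antisymm (rank_conformalBlocks_swapLast_le M i j k)
    (rank_conformalBlocks_swapLast_le M i k j)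

end VModule

theorem proposition7p5 {V : Type*} [AddCommGroup V] [Module ℂ V] (A : VertexOperatorAlgebra V)
    {W : Fin 3 → Type*} [∀ i, AddCommGroup (W i)] [∀ i, Module ℂ (W i)]
    (M : ∀ i, VModule A (W i)) (σ : Equiv.Perm (Fin 3)) :
    fusionNumber (M 0) (M 1) (M 2) = fusionNumber (M (σ 0)) (M (σ 1)) (M (σ 2)) := by
  have h01 := VModule.fusionNumber_swapFirst M
  have h12 := VModule.fusionNumber_swapLast M
  have n01 : σ 0 ≠ σ 1 := σ.injective.ne (by decide)
  have n02 : σ 0 ≠ σ 2 := σ.injective.ne (by decide)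
  have n12 : σ 1 ≠ σ 2 := σ.injective.ne (by decide)
  have key : ∀ i j k : Fin 3, i ≠ j → i ≠ k → j ≠ k →
      fusionNumber (M 0) (M 1) (M 2) = fusionNumber (M i) (M j) (M k) := by
    intro i j k hij hik hjk
    -- Triples with a repetition are absurd; each of the six others is reached from (0, 1, 2) by at
    -- most three adjacent transpositions.
    fin_cases i <;> fin_cases j <;> fin_cases k <;> first
      | exact absurd rfl hij
      | exact absurd rfl hik
      | exact absurd rfl hjk
      | rfl
      | exact h01 0 1 2
      | exact h12 0 1 2
      | exact (h01 0 1 2).trans (h12 1 0 2)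
      | exact (h12 0 1 2).trans (h01 0 2 1)
      | exact ((h12 0 1 2).trans (h01 0 2 1)).trans (h12 2 0 1)
  exact key _ _ _ n01 n02 n12
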